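/- Let $a,b,c$ be integers with $1\le a\le b\le c$, $b\ge 2$ and $a+b+c=11$, and let $\Theta(a,b,c)$ be the theta graph, that is, the simple graph with $a+b+c-1$ vertices and $a+b+c$ edges that consists of three paths of lengths $a$, $b$ and $c$ with common end points but otherwise pairwise disjoint. For a simple graph $G$ and an integer $n\ge 0$, a $G$ design of order $n$ is a partition of the edge set of the complete graph $K_n$ into edge sets of graphs each isomorphic to $G$ (for $n=0$ and $n=1$ the empty partition is one). Then, for every integer $n\ge 0$, a $\Theta(a,b,c)$ design of order $n$ exists if and only if $n\equiv 0$ or $1 \pmod{11}$. -/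

import Mathlib

/-- `K` has a decomposition into `G`: there is a collection `S` of subgraphs of `K`, each isomorphic
to `G`, such that every edge of `K` belongs to exactly one member of `S`. -/
def HasDecomposition {V W : Type*} (K : SimpleGraph V) (G : SimpleGraph W) : Prop :=
  ∃ S : Set K.Subgraph,
    (∀ H ∈ S, Nonempty (H.coe ≃g G)) ∧
    ∀ e ∈ K.edgeSet, ∃! H : K.Subgraph, H ∈ S ∧ e ∈ H.edgeSet

/-- There is a `G` design of order `n`: the complete graph on `n` vertices has a decomposition
into `G`. -/
def HasDesign {W : Type*} (G : SimpleGraph W) (n : ℕ) : Prop :=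
  HasDecomposition (⊤ : SimpleGraph (Fin n)) G

/-- The `i`-th vertex (`0 ≤ i ≤ l`) of a path of length `l` from the vertex `0` to the vertex `1`
whose internal vertices are `s + 1, s + 2, …, s + (l - 1)`, in this order. -/
def thetaPathVertex (l s i : ℕ) : ℕ :=
  if i = 0 then 0 else if i = l then 1 else s + i

/-- The theta graph `Θ(a,b,c)` (meant for `1 ≤ a ≤ b ≤ c` and `2 ≤ b`): three paths of lengths
`a`, `b`, `c` between the vertices `0` and `1`, the internal vertices being `2, …, a` on the first
path, `a + 1, …, a + b - 1` on the second and `a + b, …, a + b + c - 2` on the third. -/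
def thetaGraph (a b c : ℕ) : SimpleGraph (Fin (a + b + c - 1)) :=
  SimpleGraph.fromRel fun u v =>
    (∃ i < a, u.val = thetaPathVertex a 1 i ∧ v.val = thetaPathVertex a 1 (i + 1)) ∨
    (∃ i < b, u.val = thetaPathVertex b a i ∧ v.val = thetaPathVertex b a (i + 1)) ∨
    (∃ i < c, u.val = thetaPathVertex c (a + b - 1) i ∧
      v.val = thetaPathVertex c (a + b - 1) (i + 1))

/-! Necessity: a design splits the n(n-1)/2 edges of K_n into classes of size 11, and 11 is prime,
so 11 divides n or n-1 (`HasDesign.mod_eleven`).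

Sufficiency: write n = 11t or n = 11t+1, and let K[m] be the blow-up of a graph K, each vertex being
replaced by m independent points. If K_t[m] decomposes, then placing a design of order m on each
group, or one of order m+1 on each group together with a common extra point, gives designs of orders
tm and tm+1 (`EdgeDecomposable.fill`, `EdgeDecomposable.fill_option`). For t = 2s this is used with
K_s[22]. For t = 2s+1, K_t is K_s[2] together with s triangles through a new point, so K_t[11]
splits into K_s[22] and copies of K_3[11] (`BlowUpDecomposable.option_prod`).

It remains to decompose K_s[22]. For s ≥ 6, K_s is a disjoint union of triangles with at most two
pendant edges at one vertex (`blowUpDecomposable_nonDiag`), and the blow-ups of these three graphs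
by 22 decompose. Lone edges would not do: their blow-ups are bipartite, while the theta graph has an
odd cycle unless a, b, c are all odd. The splitting of K_s is explicit for s ≤ 22 and comes from
cyclic differences for larger s. The cases s = 3, 4 are direct. The values s = 2, 5 are avoided: the
corresponding t = 4, 5 are direct, and t = 10, 11 come from pairwise balanced designs with blocks of
sizes 3, 4, 5.

For each of the nine triples (a,b,c) this leaves eleven finite decompositions
(`BaseDecompositions`). They are given by base blocks under a cyclic group and verified by kernel
evaluation. -/

/-- The edge set `P` is the disjoint union of the edge sets of copies of `G`. -/
def EdgeDecomposable {V W : Type*} (G : SimpleGraph W) (P : Set (Sym2 V)) : Prop :=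
  ∃ F : Set (W ↪ V), F.PairwiseDisjoint (fun f => Sym2.map f '' G.edgeSet) ∧
    ⋃ f ∈ F, Sym2.map f '' G.edgeSet = P

/-- The pairs of distinct elements of `V`, i.e. the edges of the complete graph on `V`. -/
def nonDiag (V : Type*) : Set (Sym2 V) := {e | ¬ e.IsDiag}

@[simp] lemma mk_mem_nonDiag {V : Type*} {x y : V} : s(x, y) ∈ nonDiag V ↔ x ≠ y := by
  simp [nonDiag]

/-! ### Edge decompositions: unions, relabelling, passage to designs -/

namespace EdgeDecomposable

variable {V V' W ι : Type*} {G : SimpleGraph W}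

lemma iUnion {P : ι → Set (Sym2 V)} (hd : Pairwise (Function.onFun Disjoint P))
    (h : ∀ i, EdgeDecomposable G (P i)) : EdgeDecomposable G (⋃ i, P i) := by
  choose F hF hP using h
  have hsub : ∀ i, ∀ f ∈ F i, Sym2.map f '' G.edgeSet ⊆ P i := fun i f hf => by
    rw [← hP i]; exact Set.subset_biUnion_of_mem (u := fun f : W ↪ V => Sym2.map f '' G.edgeSet) hf
  refine ⟨⋃ i, F i, ?_, ?_⟩
  · intro f hf g hg hfg
    obtain ⟨i, hi⟩ := Set.mem_iUnion.1 hf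
    obtain ⟨j, hj⟩ := Set.mem_iUnion.1 hg
    by_cases hij : i = j
    · subst hij; exact hF i hi hj hfg
    · exact (hd hij).mono (hsub i f hi) (hsub j g hj)
  · rw [Set.biUnion_iUnion]
    exact Set.iUnion_congr hP

lemma empty : EdgeDecomposable G (∅ : Set (Sym2 V)) :=
  ⟨∅, by simp, by simp⟩

lemma union {P Q : Set (Sym2 V)} (hd : Disjoint P Q) (hP : EdgeDecomposable G P)
    (hQ : EdgeDecomposable G Q) : EdgeDecomposable G (P ∪ Q) := by
  rw [Set.union_eq_iUnion]
  refine iUnion ?_ (by rintro (_ | _) <;> assumption)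
  rintro (_ | _) (_ | _) h
  exacts [(h rfl).elim, hd.symm, hd, (h rfl).elim]

lemma image {P : Set (Sym2 V)} (h : EdgeDecomposable G P) (g : V ↪ V') :
    EdgeDecomposable G (Sym2.map g '' P) := by
  obtain ⟨F, hF, rfl⟩ := h
  have key : ∀ f : W ↪ V, Sym2.map (f.trans g) '' G.edgeSet =
      Sym2.map g '' (Sym2.map f '' G.edgeSet) := fun f => by
    rw [← Set.image_comp, ← Sym2.map_comp]; rfl
  refine ⟨(fun f => f.trans g) '' F, ?_, ?_⟩
  · rintro _ ⟨f, hf, rfl⟩ _ ⟨f', hf', rfl⟩ hne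
    simp only [Function.onFun, key]
    exact (Set.disjoint_image_iff (Sym2.map.injective g.injective)).2
      (hF hf hf' fun h => hne (by rw [h]))
  · simp only [Set.biUnion_image, key, Set.image_iUnion]

lemma copy (f : W ↪ V) : EdgeDecomposable G (Sym2.map f '' G.edgeSet) :=
  ⟨{f}, by simp, by simp⟩

lemma nonDiag_congr (e : V ≃ V') (h : EdgeDecomposable G (nonDiag V)) :
    EdgeDecomposable G (nonDiag V') := by
  convert h.image e.toEmbedding
  ext x
  induction x with | _ x y =>
  constructor
  · intro hx
    exact ⟨s(e.symm x, e.symm y), by simpa using hx, by simp⟩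
  · rintro ⟨z, hz, hzx⟩
    induction z with | _ z w =>
    rw [← hzx]
    simpa using hz

lemma hasDesign {n : ℕ} (h : EdgeDecomposable G (nonDiag (Fin n))) : HasDesign G n := by
  obtain ⟨F, hF, hP⟩ := h
  let c : (W ↪ Fin n) → SimpleGraph.Copy G (⊤ : SimpleGraph (Fin n)) := fun f =>
    ⟨⟨f, fun h => f.injective.ne h.ne⟩, f.injective⟩
  have hc : ∀ f, (c f).toSubgraph.edgeSet = Sym2.map f '' G.edgeSet := fun f => by
    simp only [SimpleGraph.Copy.toSubgraph, SimpleGraph.Subgraph.edgeSet_map]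
    simp [c]
  refine ⟨(fun f => (c f).toSubgraph) '' F, ?_, ?_⟩
  · rintro _ ⟨f, -, rfl⟩
    exact ⟨(c f).isoToSubgraph.symm⟩
  · intro e he
    have he' : e ∈ nonDiag (Fin n) := by
      induction e with | _ x y => simpa using he
    rw [← hP] at he'
    simp only [Set.mem_iUnion, exists_prop] at he'
    obtain ⟨f, hf, hef⟩ := he'
    refine ⟨(c f).toSubgraph, ⟨⟨f, hf, rfl⟩, by rwa [hc]⟩, ?_⟩
    rintro _ ⟨⟨g, hg, rfl⟩, heg⟩
    dsimp only at heg ⊢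
    rw [hc] at heg
    rw [hF.elim_set hf hg e hef heg]

end EdgeDecomposable

/-! ### Necessity: counting edges -/

/-- A graph with `m` edges has designs only of orders `n` with `m ∣ n.choose 2`. -/
lemma HasDesign.card_edgeFinset_dvd {W : Type*} [Fintype W] {G : SimpleGraph W}
    [Fintype G.edgeSet] {n : ℕ} (h : HasDesign G n) : G.edgeFinset.card ∣ n.choose 2 := by
  classical
  obtain ⟨S, hS, hex⟩ := h
  have hSf : S.Finite := Set.toFinite S
  have hcard : ∀ H ∈ S, H.edgeSet.toFinset.card = G.edgeFinset.card := by
    intro H hH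
    obtain ⟨φ⟩ := hS H hH
    have h1 : Nat.card H.coe.edgeSet = Nat.card G.edgeSet := Nat.card_congr φ.mapEdgeSet
    have h2 : Nat.card H.coe.edgeSet = Nat.card H.edgeSet := by
      rw [← SimpleGraph.Subgraph.image_coe_edgeSet_coe H]
      exact (Nat.card_image_of_injective (Sym2.map.injective Subtype.val_injective) _).symm
    rw [Set.toFinset_card, ← Nat.card_eq_fintype_card, ← h2, h1, Nat.card_eq_fintype_card,
      SimpleGraph.edgeFinset_card]
  have hU : (⊤ : SimpleGraph (Fin n)).edgeFinset =
      hSf.toFinset.biUnion fun H => H.edgeSet.toFinset := by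
    ext e
    simp only [SimpleGraph.mem_edgeFinset, Finset.mem_biUnion, Set.Finite.mem_toFinset,
      Set.mem_toFinset]
    constructor
    · intro he
      obtain ⟨H, hH, -⟩ := hex e he
      exact ⟨H, hH⟩
    · rintro ⟨H, -, he⟩
      exact H.edgeSet_subset he
  have hN : (⊤ : SimpleGraph (Fin n)).edgeFinset.card = n.choose 2 := by
    rw [SimpleGraph.card_edgeFinset_top_eq_card_choose_two, Fintype.card_fin]
  rw [← hN, hU, Finset.card_biUnion]
  · rw [Finset.sum_congr rfl fun H hH => hcard H (hSf.mem_toFinset.1 hH), Finset.sum_const,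
      smul_eq_mul]
    exact dvd_mul_left _ _
  · intro H hH H' hH' hne
    rw [Function.onFun, Finset.disjoint_left]
    intro e he he'
    simp only [Set.mem_toFinset] at he he'
    exact hne ((hex e (H.edgeSet_subset he)).unique ⟨hSf.mem_toFinset.1 hH, he⟩
      ⟨hSf.mem_toFinset.1 hH', he'⟩)

/-! ### Checking partitions of edge lists by computation -/

/-- The edges listed in `L`, as a set of unordered pairs of elements of `Fin N`. -/
def patternEdges (N : ℕ) (L : List (ℕ × ℕ)) : Set (Sym2 (Fin N)) :=
  {e | ∃ p ∈ L, e.map Fin.val = s(p.1, p.2)}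

/-- An injective encoding of the unordered pairs of numbers below `N`. -/
def edgeCode (N : ℕ) (p : ℕ × ℕ) : ℕ := min p.1 p.2 * N + max p.1 p.2

lemma edgeCode_inj {N : ℕ} {p q : ℕ × ℕ} (hp : p.1 < N ∧ p.2 < N) (hq : q.1 < N ∧ q.2 < N)
    (h : edgeCode N p = edgeCode N q) : s(p.1, p.2) = s(q.1, q.2) := by
  have hN : 0 < N := by omega
  have hmod : ∀ r : ℕ × ℕ, r.1 < N ∧ r.2 < N →
      edgeCode N r / N = min r.1 r.2 ∧ edgeCode N r % N = max r.1 r.2 := fun r hr => by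
    have : max r.1 r.2 < N := max_lt hr.1 hr.2
    rw [edgeCode, add_comm, Nat.add_mul_div_right _ _ hN, Nat.add_mul_mod_self_right,
      Nat.div_eq_of_lt this, Nat.mod_eq_of_lt this]
    simp
  have h1 := (hmod p hp).1.symm.trans ((congrArg (· / N) h).trans (hmod q hq).1)
  have h2 := (hmod p hp).2.symm.trans ((congrArg (· % N) h).trans (hmod q hq).2)
  rw [Sym2.eq_iff]
  omega

lemma edgeCode_congr {N : ℕ} {p q : ℕ × ℕ} (h : s(p.1, p.2) = s(q.1, q.2)) :
    edgeCode N p = edgeCode N q := by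
  rw [Sym2.eq_iff] at h
  obtain ⟨h1, h2⟩ | ⟨h1, h2⟩ := h
  · rw [edgeCode, edgeCode, h1, h2]
  · rw [edgeCode, edgeCode, h1, h2, min_comm, max_comm]

/-- The bit mask of the set of the numbers in a list, or `none` if the list has a repetition;
`acc` is the bit mask of the numbers seen before. -/
def collectBits : ℕ → List ℕ → Option ℕ
  | acc, [] => some acc
  | acc, c :: l => if acc.testBit c then none else collectBits (acc ||| 1 <<< c) l

/-- Bit masks make a set of codes a single natural number: absence of repetition gives disjointness,
and equality of two masks gives equality of the sets covered. Both are cheap to evaluate in the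
kernel. -/
lemma collectBits_spec {l : List ℕ} {acc t : ℕ} (h : collectBits acc l = some t) :
    l.Nodup ∧ (∀ c ∈ l, acc.testBit c = false) ∧
      ∀ c, t.testBit c = true ↔ acc.testBit c = true ∨ c ∈ l := by
  induction l generalizing acc with
  | nil =>
    obtain rfl : acc = t := by simpa only [collectBits, Option.some.injEq] using h
    exact ⟨List.nodup_nil, fun _ h => (List.not_mem_nil h).elim, fun c =>
      ⟨Or.inl, fun h => h.resolve_right List.not_mem_nil⟩⟩
  | cons a l ih =>
    simp only [collectBits] at h
    split at h
    · cases h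
    · rename_i ha
      obtain ⟨h1, h2, h3⟩ := ih h
      have hbit : ∀ c, (acc ||| 1 <<< a).testBit c = true ↔ acc.testBit c = true ∨ c = a := by
        intro c
        rw [Nat.testBit_or, Nat.one_shiftLeft, Nat.testBit_two_pow]
        rw [Bool.or_eq_true, decide_eq_true_eq, eq_comm (a := a)]
      have h2' : ∀ c ∈ l, ¬ acc.testBit c = true ∧ c ≠ a := fun c hc => by
        have := h2 c hc
        rw [← Bool.not_eq_true, hbit] at this
        tauto
      refine ⟨List.nodup_cons.2 ⟨fun hal => (h2' a hal).2 rfl, h1⟩, ?_, ?_⟩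
      · intro c hc
        rcases List.mem_cons.1 hc with rfl | hc
        · simpa using ha
        · simpa using (h2' c hc).1
      · intro c
        rw [h3, hbit, List.mem_cons]
        tauto

/-- The edges of the copy of the pattern `it.2` on the vertices listed in `it.1`. -/
def itemEdges (it : List ℕ × List (ℕ × ℕ)) : List (ℕ × ℕ) :=
  it.2.map fun p => (it.1.getD p.1 0, it.1.getD p.2 0)

/-- Whether the vertices of the item `it` are distinct and less than `N`, and its pattern has edges
only between positions in the list of these vertices. -/
def itemValid (N : ℕ) (it : List ℕ × List (ℕ × ℕ)) : Bool :=
  it.1.all (fun x => x < N) && (collectBits 0 it.1).isSome &&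
    it.2.all (fun p => p.1 < it.1.length && p.2 < it.1.length)

/-- Whether the edges listed in `targets` are partitioned by the items. -/
def checkPartition (N : ℕ) (targets : List (ℕ × ℕ)) (items : List (List ℕ × List (ℕ × ℕ))) :
    Bool :=
  items.all (itemValid N) && targets.all (fun p => p.1 < N && p.2 < N) &&
    match collectBits 0 ((items.flatMap itemEdges).map (edgeCode N)),
      collectBits 0 (targets.map (edgeCode N)) with
    | some a, some b => a == b
    | _, _ => false

lemma itemEdges_lt {N : ℕ} {it : List ℕ × List (ℕ × ℕ)} (h : itemValid N it = true) :
    ∀ p ∈ itemEdges it, p.1 < N ∧ p.2 < N := by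
  simp only [itemValid, Bool.and_eq_true, List.all_eq_true, decide_eq_true_eq] at h
  simp only [itemEdges, List.mem_map]
  rintro _ ⟨p, hp, rfl⟩
  obtain ⟨h1, h2⟩ := h.2 p hp
  simp only [List.getD_eq_getElem _ _ h1, List.getD_eq_getElem _ _ h2]
  exact ⟨h.1.1 _ (List.getElem_mem _), h.1.1 _ (List.getElem_mem _)⟩

lemma itemValid.image {N : ℕ} {it : List ℕ × List (ℕ × ℕ)} (h : itemValid N it = true) :
    ∃ f : Fin it.1.length ↪ Fin N,
      Sym2.map f '' patternEdges it.1.length it.2 = patternEdges N (itemEdges it) := by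
  simp only [itemValid, Bool.and_eq_true, List.all_eq_true, decide_eq_true_eq,
    Option.isSome_iff_exists] at h
  obtain ⟨⟨h1, t, ht⟩, h3⟩ := h
  have hnd := (collectBits_spec ht).1
  refine ⟨⟨fun i => ⟨it.1[i], h1 _ (List.getElem_mem _)⟩, fun i j hij => ?_⟩, ?_⟩
  · exact Fin.ext ((List.Nodup.getElem_inj_iff hnd).1 (Fin.mk.inj_iff.1 hij))
  · ext e
    constructor
    · rintro ⟨e, ⟨p, hp, hpe⟩, rfl⟩
      obtain ⟨hp1, hp2⟩ := h3 p hp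
      have he : e = s(⟨p.1, hp1⟩, ⟨p.2, hp2⟩) :=
        Sym2.map.injective Fin.val_injective (by rw [hpe]; rfl)
      refine ⟨_, List.mem_map.2 ⟨p, hp, rfl⟩, ?_⟩
      simp [he, hp1, hp2]
    · rintro ⟨_, hq, he⟩
      obtain ⟨p, hp, rfl⟩ := List.mem_map.1 hq
      obtain ⟨hp1, hp2⟩ := h3 p hp
      refine ⟨s(⟨p.1, hp1⟩, ⟨p.2, hp2⟩), ⟨p, hp, rfl⟩, ?_⟩
      apply Sym2.map.injective Fin.val_injective
      rw [he]
      simp [hp1, hp2]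

/-- The property `Φ` is left arbitrary so that one check serves both decompositions into copies of a
graph and decompositions of blow-ups: only closure under disjoint unions is used. -/
theorem checkPartition_sound {N : ℕ} {targets : List (ℕ × ℕ)}
    {items : List (List ℕ × List (ℕ × ℕ))} (h : checkPartition N targets items = true)
    (Φ : Set (Sym2 (Fin N)) → Prop)
    (hΦ : ∀ S : Fin items.length → Set (Sym2 (Fin N)), Pairwise (Function.onFun Disjoint S) →
      (∀ i, Φ (S i)) → Φ (⋃ i, S i))
    (hitems : ∀ it ∈ items, ∀ f : Fin it.1.length ↪ Fin N,
      Φ (Sym2.map f '' patternEdges it.1.length it.2)) :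
    Φ (patternEdges N targets) := by
  simp only [checkPartition, Bool.and_eq_true] at h
  obtain ⟨⟨hv, hlt⟩, h⟩ := h
  split at h
  swap
  · cases h
  rename_i a b ha hb
  simp only [List.all_eq_true, Bool.and_eq_true, decide_eq_true_eq] at hv hlt
  obtain ⟨hnd, -, hmem⟩ := collectBits_spec ha
  obtain ⟨-, -, hmem'⟩ := collectBits_spec hb
  obtain rfl : a = b := by simpa using h
  have hiff : ∀ c, c ∈ (items.flatMap itemEdges).map (edgeCode N) ↔
      c ∈ targets.map (edgeCode N) := fun c => by
    have h1 := hmem c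
    have h2 := hmem' c
    simp only [Nat.zero_testBit, Bool.false_eq_true, false_or] at h1 h2
    rw [← h1, h2]
  have hfl : ∀ p ∈ items.flatMap itemEdges, p.1 < N ∧ p.2 < N := fun p hp => by
    obtain ⟨it, hit, hp⟩ := List.mem_flatMap.1 hp
    exact itemEdges_lt (hv it hit) p hp
  have hdisj := (List.nodup_flatMap.1 hnd.of_map).2
  have hP : patternEdges N targets =
      ⋃ i : Fin items.length, patternEdges N (itemEdges items[i]) := by
    ext e
    simp only [Set.mem_iUnion]
    constructor
    · rintro ⟨p, hp, he⟩
      obtain ⟨q, hq, hqp⟩ := List.mem_map.1 ((hiff _).2 (List.mem_map_of_mem hp))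
      obtain ⟨it, hit, hq'⟩ := List.mem_flatMap.1 hq
      obtain ⟨i, hi, rfl⟩ := List.getElem_of_mem hit
      exact ⟨⟨i, hi⟩, q, hq', he.trans (edgeCode_inj (hlt p hp) (hfl q hq) hqp.symm)⟩
    · rintro ⟨i, p, hp, he⟩
      have hp' : p ∈ items.flatMap itemEdges :=
        List.mem_flatMap.2 ⟨_, List.getElem_mem _, hp⟩
      obtain ⟨q, hq, hqp⟩ := List.mem_map.1 ((hiff _).1 (List.mem_map_of_mem hp'))
      exact ⟨q, hq, he.trans (edgeCode_inj (hfl p hp') (hlt q hq) hqp.symm)⟩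
  rw [hP]
  have hlt' : ∀ i j : Fin items.length, i < j →
      Disjoint (patternEdges N (itemEdges items[i])) (patternEdges N (itemEdges items[j])) := by
    intro i j hij
    rw [Set.disjoint_left]
    rintro e ⟨p, hp, he⟩ ⟨q, hq, he'⟩
    have hp' : p ∈ items.flatMap itemEdges := List.mem_flatMap.2 ⟨_, List.getElem_mem _, hp⟩
    have hq' : q ∈ items.flatMap itemEdges := List.mem_flatMap.2 ⟨_, List.getElem_mem _, hq⟩
    -- The same edge could be listed as (u, v) and as (v, u), but these have equal codes. Since the
    -- codes have no repetition, a common edge comes from one and the same listed pair.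
    have hpq : p = q := List.inj_on_of_nodup_map hnd hp' hq' (edgeCode_congr (he.symm.trans he'))
    have := List.pairwise_iff_getElem.1 hdisj i j i.2 j.2 hij
    exact this hp (hpq ▸ hq)
  refine hΦ _ (fun i j hij => ?_) fun i => ?_
  · rcases lt_or_gt_of_ne hij with h | h
    exacts [hlt' i j h, (hlt' j i h).symm]
  · obtain ⟨f, hf⟩ := itemValid.image (hv _ (List.getElem_mem i.2))
    rw [Fin.getElem_fin, ← hf]
    exact hitems _ (List.getElem_mem _) f

/-- The edges of the complete graph on `0, …, N - 1`. -/
def completePairs (N : ℕ) : List (ℕ × ℕ) :=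
  (List.range N).flatMap fun v => (List.range v).map fun u => (u, v)

lemma patternEdges_completePairs (N : ℕ) : patternEdges N (completePairs N) = nonDiag (Fin N) := by
  ext e
  induction e with | _ x y =>
  simp only [patternEdges, completePairs, Set.mem_ofPred_eq, List.mem_flatMap, List.mem_map,
    List.mem_range, mk_mem_nonDiag, Sym2.map_mk, ne_eq, Fin.ext_iff]
  constructor
  · rintro ⟨_, ⟨v, hv, u, hu, rfl⟩, h⟩
    rw [Sym2.eq_iff] at h
    omega
  · intro h
    rcases lt_or_gt_of_ne h with h | h
    · exact ⟨_, ⟨y, y.2, x, h, rfl⟩, rfl⟩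
    · exact ⟨_, ⟨x, x.2, y, h, rfl⟩, Sym2.eq_swap⟩

/-! ### Cyclic development and blow-ups -/

/-- Translation by `z` modulo `r` in each of the `k` blocks of `r` consecutive numbers. -/
def blockTranslate (r k z v : ℕ) : ℕ := if v < k * r then v / r * r + (v + z) % r else v

/-- All translates of the given blocks. -/
def develop (r k : ℕ) (blocks : List (List ℕ)) : List (List ℕ) :=
  (List.range r).flatMap fun z => blocks.map fun B => B.map (blockTranslate r k z)

/-- The graph with edge set `P`, blown up by `m`, decomposes into copies of `G`. -/
def BlowUpDecomposable {T W : Type*} (G : SimpleGraph W) (m : ℕ) (P : Set (Sym2 T)) : Prop :=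
  EdgeDecomposable G (Sym2.map Prod.fst ⁻¹' P : Set (Sym2 (T × Fin m)))

namespace BlowUpDecomposable

variable {T T' W ι : Type*} {G : SimpleGraph W} {m : ℕ}

lemma iUnion {P : ι → Set (Sym2 T)} (hd : Pairwise (Function.onFun Disjoint P))
    (h : ∀ i, BlowUpDecomposable G m (P i)) : BlowUpDecomposable G m (⋃ i, P i) := by
  rw [BlowUpDecomposable, Set.preimage_iUnion]
  exact EdgeDecomposable.iUnion (fun i j hij => (hd hij).preimage _) h

lemma union {P Q : Set (Sym2 T)} (hd : Disjoint P Q) (hP : BlowUpDecomposable G m P)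
    (hQ : BlowUpDecomposable G m Q) : BlowUpDecomposable G m (P ∪ Q) :=
  EdgeDecomposable.union (hd.preimage _) hP hQ

lemma image {P : Set (Sym2 T)} (h : BlowUpDecomposable G m P) (g : T ↪ T') :
    BlowUpDecomposable G m (Sym2.map g '' P) := by
  have h' := EdgeDecomposable.image h (g.prodMap (Function.Embedding.refl (Fin m)))
  unfold BlowUpDecomposable
  convert h'
  ext e
  induction e with | _ x y =>
  constructor
  · rintro ⟨e, he, hxy⟩
    induction e with | _ a b =>
    simp only [Sym2.map_mk, Sym2.eq_iff] at hxy
    rcases hxy with ⟨h1, h2⟩ | ⟨h1, h2⟩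
    · exact ⟨s((a, x.2), (b, y.2)), he, by simp [h1, h2]⟩
    · refine ⟨s((b, x.2), (a, y.2)), by simpa [Sym2.eq_swap] using he, by simp [h1, h2]⟩
  · rintro ⟨e, he, hxy⟩
    induction e with | _ a b =>
    rw [← hxy]
    exact ⟨s(a.1, b.1), he, by simp⟩

lemma nonDiag_congr (e : T ≃ T') (h : BlowUpDecomposable G m (nonDiag T)) :
    BlowUpDecomposable G m (nonDiag T') := by
  convert h.image e.toEmbedding
  ext x
  induction x with | _ x y =>
  constructor
  · intro hx
    exact ⟨s(e.symm x, e.symm y), by simpa using hx, by simp⟩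
  · rintro ⟨z, hz, hzx⟩
    induction z with | _ z w =>
    rw [← hzx]
    simpa using hz

end BlowUpDecomposable

/-- Translation of the second coordinate. -/
def shiftSnd {k r : ℕ} [NeZero r] (z : Fin r) (x : Fin k × Fin r) : Fin k × Fin r :=
  (x.1, x.2 + z)

/-- The orbit under translation of a pair of vertices in different parts, as a number. -/
def orbitCode {k r : ℕ} (x y : Fin k × Fin r) : ℕ :=
  if x.1 < y.1 then (x.1 * k + y.1) * r + (y.2 - x.2 : Fin r)
  else (y.1 * k + x.1) * r + (x.2 - y.2 : Fin r)

section orbitCode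

variable {k r : ℕ}

lemma orbitCode_symm {x y : Fin k × Fin r} (h : x.1 ≠ y.1) : orbitCode x y = orbitCode y x := by
  rcases lt_or_gt_of_ne h with h | h
  · rw [orbitCode, orbitCode, if_pos h, if_neg h.asymm]
  · rw [orbitCode, orbitCode, if_pos h, if_neg h.asymm]

lemma orbitCode_shiftSnd [NeZero r] (z : Fin r) (x y : Fin k × Fin r) :
    orbitCode (shiftSnd z x) (shiftSnd z y) = orbitCode x y := by
  simp only [orbitCode, shiftSnd, add_sub_add_right_eq_sub]

lemma orbitCode_aux {a b c d e f : ℕ} (hb : b < k) (he : e < k) (hc : c < r) (hf : f < r)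
    (h : (a * k + b) * r + c = (d * k + e) * r + f) : a = d ∧ b = e ∧ c = f := by
  have hr : 0 < r := by omega
  have hk : 0 < k := by omega
  have h1 := congrArg (· / r) h
  have h2 := congrArg (· % r) h
  simp only [add_comm _ c, add_comm _ f, Nat.add_mul_mod_self_right,
    Nat.add_mul_div_right _ _ hr, Nat.mod_eq_of_lt hc, Nat.mod_eq_of_lt hf,
    Nat.div_eq_of_lt hc, Nat.div_eq_of_lt hf, zero_add] at h1 h2
  have h3 := congrArg (· / k) h1
  have h4 := congrArg (· % k) h1
  simp only [add_comm _ b, add_comm _ e, Nat.add_mul_mod_self_right,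
    Nat.add_mul_div_right _ _ hk, Nat.mod_eq_of_lt hb, Nat.mod_eq_of_lt he,
    Nat.div_eq_of_lt hb, Nat.div_eq_of_lt he, zero_add] at h3 h4
  exact ⟨h3, h4, h2⟩

/-- The code records the two parts, in increasing order, and the difference of the second
coordinates. These determine a pair across two parts up to translation, so equal codes mean equal
orbits. -/
lemma exists_shiftSnd_of_orbitCode_eq [NeZero r] {x y x' y' : Fin k × Fin r} (h : x.1 ≠ y.1)
    (h' : x'.1 ≠ y'.1) (hc : orbitCode x y = orbitCode x' y') :
    ∃ z, s(x', y') = s(shiftSnd z x, shiftSnd z y) := by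
  have key : ∀ {x y x' y' : Fin k × Fin r}, x.1 < y.1 → x'.1 < y'.1 →
      orbitCode x y = orbitCode x' y' → ∃ z, s(x', y') = s(shiftSnd z x, shiftSnd z y) := by
    intro x y x' y' h h' hc
    rw [orbitCode, orbitCode, if_pos h, if_pos h'] at hc
    obtain ⟨h1, h2, h3⟩ := orbitCode_aux y.1.2 y'.1.2 (y.2 - x.2).2 (y'.2 - x'.2).2 hc
    refine ⟨x'.2 - x.2, ?_⟩
    have e1 : x' = shiftSnd (x'.2 - x.2) x :=
      Prod.ext (Fin.ext h1.symm) (by simp [shiftSnd])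
    have e2 : y' = shiftSnd (x'.2 - x.2) y := by
      refine Prod.ext (Fin.ext h2.symm) ?_
      have h3 := Fin.ext h3
      rw [sub_eq_iff_eq_add] at h3
      simp only [shiftSnd]
      rw [h3]
      abel
    rw [← e1, ← e2]
  rcases lt_or_gt_of_ne h with h1 | h1 <;> rcases lt_or_gt_of_ne h' with h2 | h2
  · exact key h1 h2 hc
  · rw [orbitCode_symm h'] at hc
    obtain ⟨z, hz⟩ := key h1 h2 hc
    exact ⟨z, by rw [Sym2.eq_swap, hz]⟩
  · rw [orbitCode_symm h] at hc
    obtain ⟨z, hz⟩ := key h1 h2 hc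
    exact ⟨z, by rw [hz, Sym2.eq_swap]⟩
  · rw [orbitCode_symm h, orbitCode_symm h'] at hc
    obtain ⟨z, hz⟩ := key h1 h2 hc
    exact ⟨z, by rw [Sym2.eq_swap, hz, Sym2.eq_swap]⟩

end orbitCode

/-- `orbitCode` in terms of the numbers `i * r + x` that stand for the vertices `(i, x)`. -/
def orbitCodeNat (k r u v : ℕ) : ℕ :=
  if u / r < v / r then (u / r * k + v / r) * r + (r - u % r + v % r) % r
  else (v / r * k + u / r) * r + (r - v % r + u % r) % r

lemma orbitCodeNat_eq {k r u v : ℕ} (hu : u < k * r) (hv : v < k * r) :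
    orbitCodeNat k r u v =
      orbitCode (finProdFinEquiv.symm ⟨u, hu⟩) (finProdFinEquiv.symm ⟨v, hv⟩) := by
  simp only [orbitCodeNat, orbitCode, finProdFinEquiv_symm_apply, Fin.lt_def, Fin.coe_divNat,
    Fin.sub_def, Fin.coe_modNat]

/-- Whether the translates modulo `r` of the copies of the graph `E` on the given lists of `w`
vertices partition the blow-up by `r` of the graph on `0, …, k - 1` with the edges in `L`. -/
def checkDevelopment (k r w : ℕ) (L E : List (ℕ × ℕ)) (blocks : List (List ℕ)) : Bool :=
  blocks.all (fun B => B.length == w && B.all (fun x => x < k * r) &&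
    (collectBits 0 B).isSome) &&
  L.all (fun p => p.1 < p.2 && p.2 < k) && E.all (fun p => p.1 < w && p.2 < w) &&
    match collectBits 0 (blocks.flatMap fun B => E.map fun p =>
        orbitCodeNat k r (B.getD p.1 0) (B.getD p.2 0)),
      collectBits 0 (L.flatMap fun p => (List.range r).map fun d => (p.1 * k + p.2) * r + d) with
    | some a, some b => a == b
    | _, _ => false

/-- Translation acts freely on the edges of the blow-up: the ends of an edge lie in different parts,
which translation preserves, so they cannot be exchanged. Hence it is enough that the base blocks
meet each orbit over `L` exactly once, and only the list of orbits is checked. -/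
theorem checkDevelopment_sound {k r w : ℕ} [NeZero r] {L E : List (ℕ × ℕ)}
    {blocks : List (List ℕ)} {G : SimpleGraph (Fin w)} (hG : G.edgeSet = patternEdges w E)
    (h : checkDevelopment k r w L E blocks = true) :
    BlowUpDecomposable G r (patternEdges k L) := by
  simp only [checkDevelopment, Bool.and_eq_true] at h
  obtain ⟨⟨⟨hB, hL⟩, hE⟩, h⟩ := h
  split at h
  swap
  · cases h
  rename_i a b ha hb
  obtain rfl : a = b := by simpa using h
  simp only [List.all_eq_true, Bool.and_eq_true, decide_eq_true_eq, beq_iff_eq,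
    Option.isSome_iff_exists] at hB hL hE
  obtain ⟨hnd, -, hmem⟩ := collectBits_spec ha
  obtain ⟨-, -, hmem'⟩ := collectBits_spec hb
  have hBn : ∀ B ∈ blocks, B.Nodup := fun B hB' => by
    obtain ⟨-, t, ht⟩ := hB B hB'
    exact (collectBits_spec ht).1
  let f : Fin blocks.length → Fin w ↪ Fin k × Fin r := fun b =>
    ⟨fun i => finProdFinEquiv.symm
        ⟨(blocks.get b)[i]'(by rw [(hB _ (List.get_mem blocks b)).1.1]; exact i.2),
          (hB _ (List.get_mem blocks b)).1.2 _ (List.getElem_mem _)⟩, fun i j hij =>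
      Fin.ext ((List.Nodup.getElem_inj_iff (hBn _ (List.get_mem blocks b))).1
        (Fin.mk.inj_iff.1 (finProdFinEquiv.symm.injective hij)))⟩
  have hfcode : ∀ b (p : ℕ × ℕ) (h1 : p.1 < w) (h2 : p.2 < w),
      orbitCodeNat k r ((blocks.get b).getD p.1 0) ((blocks.get b).getD p.2 0) =
        orbitCode (f b ⟨p.1, h1⟩) (f b ⟨p.2, h2⟩) := by
    intro b p h1 h2
    have hl := (hB _ (List.get_mem blocks b)).1.1
    rw [List.getD_eq_getElem _ _ (by rwa [hl]), List.getD_eq_getElem _ _ (by rwa [hl]),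
      orbitCodeNat_eq]
    rfl
  have hcode : ∀ c, (∃ b : Fin blocks.length, ∃ p ∈ E,
      orbitCodeNat k r ((blocks.get b).getD p.1 0) ((blocks.get b).getD p.2 0) = c) ↔
      ∃ p ∈ L, ∃ d < r, (p.1 * k + p.2) * r + d = c := by
    intro c
    have h1 := hmem c
    have h2 := hmem' c
    simp only [Nat.zero_testBit, Bool.false_eq_true, false_or, List.mem_flatMap, List.mem_map,
      List.mem_range] at h1 h2
    rw [← h2, h1]
    constructor
    · rintro ⟨b, hb⟩
      exact ⟨_, List.get_mem blocks b, hb⟩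
    · rintro ⟨B, hB, hb⟩
      obtain ⟨i, hi, rfl⟩ := List.getElem_of_mem hB
      exact ⟨⟨i, hi⟩, hb⟩
  have hbase : ∀ b, ∀ p ∈ E, ∀ (h1 : p.1 < w) (h2 : p.2 < w),
      (f b ⟨p.1, h1⟩).1 ≠ (f b ⟨p.2, h2⟩).1 ∧
      s((f b ⟨p.1, h1⟩).1, (f b ⟨p.2, h2⟩).1) ∈ patternEdges k L := by
    intro b p hp h1 h2
    obtain ⟨q, hq, d, hd, hqd⟩ := (hcode _).1 ⟨b, p, hp, hfcode b p h1 h2⟩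
    obtain ⟨hq1, hq2⟩ := hL q hq
    unfold orbitCode at hqd
    split at hqd
    · rename_i hlt
      obtain ⟨e1, e2, -⟩ := orbitCode_aux hq2 (Fin.is_lt _) hd (Fin.is_lt _) hqd
      exact ⟨hlt.ne, q, hq, by simp [e1, e2]⟩
    -- In this branch the first part is at least the second. Equality would give `q.1 = q.2`,
    -- against `q.1 < q.2`.
    · obtain ⟨e1, e2, -⟩ := orbitCode_aux hq2 (Fin.is_lt _) hd (Fin.is_lt _) hqd
      refine ⟨fun hne => ?_, q, hq, by rw [e1, e2, Sym2.eq_swap]; rfl⟩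
      have := congrArg Fin.val hne
      omega
  have hshift : ∀ z : Fin r, Function.Injective (shiftSnd (k := k) z) := by
    intro z x y hxy
    simp only [shiftSnd, Prod.mk.injEq, add_left_inj] at hxy
    exact Prod.ext hxy.1 hxy.2
  let F : Fin blocks.length × Fin r → Fin w ↪ Fin k × Fin r := fun i =>
    (f i.1).trans ⟨shiftSnd i.2, hshift i.2⟩
  have hmemF : ∀ i e, e ∈ Sym2.map (F i) '' G.edgeSet ↔ ∃ p ∈ E, ∃ (h1 : p.1 < w) (h2 : p.2 < w),
      e = s(shiftSnd i.2 (f i.1 ⟨p.1, h1⟩), shiftSnd i.2 (f i.1 ⟨p.2, h2⟩)) := by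
    intro i e
    rw [hG]
    constructor
    · rintro ⟨e, ⟨p, hp, hpe⟩, rfl⟩
      obtain ⟨h1, h2⟩ := hE p hp
      have he : e = s(⟨p.1, h1⟩, ⟨p.2, h2⟩) :=
        Sym2.map.injective Fin.val_injective (by rw [hpe]; rfl)
      exact ⟨p, hp, h1, h2, by rw [he]; rfl⟩
    · rintro ⟨p, hp, h1, h2, rfl⟩
      exact ⟨s(⟨p.1, h1⟩, ⟨p.2, h2⟩), ⟨p, hp, rfl⟩, rfl⟩
  have hP : (Sym2.map Prod.fst ⁻¹' patternEdges k L : Set (Sym2 (Fin k × Fin r))) =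
      ⋃ i, Sym2.map (F i) '' G.edgeSet := by
    ext e
    simp only [Set.mem_iUnion, hmemF]
    constructor
    · induction e with | _ x y =>
      rintro ⟨q, hq, hxy⟩
      obtain ⟨hq1, hq2⟩ := hL q hq
      wlog hlt : x.1 < y.1 generalizing x y
      · have hyx : y.1 < x.1 := by
          simp only [Sym2.map_mk, Sym2.eq_iff] at hxy
          rw [Fin.lt_def] at hlt ⊢
          omega
        obtain ⟨i, p, hp, h1, h2, he⟩ := this y x (by rw [Sym2.eq_swap, ← hxy]) hyx
        exact ⟨i, p, hp, h1, h2, by rw [Sym2.eq_swap, he]⟩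
      have hxy' : x.1.val = q.1 ∧ y.1.val = q.2 := by
        simp only [Sym2.map_mk, Sym2.eq_iff] at hxy
        rw [Fin.lt_def] at hlt
        omega
      obtain ⟨b, p, hp, hc⟩ := (hcode (orbitCode x y)).2
        ⟨q, hq, _, (y.2 - x.2).2, by rw [orbitCode, if_pos hlt, hxy'.1, hxy'.2]⟩
      obtain ⟨h1, h2⟩ := hE p hp
      rw [hfcode b p h1 h2] at hc
      obtain ⟨z, hz⟩ := exists_shiftSnd_of_orbitCode_eq (hbase b p hp h1 h2).1 hlt.ne hc
      exact ⟨(b, z), p, hp, h1, h2, hz⟩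
    · rintro ⟨i, p, hp, h1, h2, rfl⟩
      exact (hbase i.1 p hp h1 h2).2
  unfold BlowUpDecomposable
  rw [hP]
  refine EdgeDecomposable.iUnion ?_ fun i => EdgeDecomposable.copy (F i)
  have hdis := (List.nodup_flatMap.1 hnd)
  rintro ⟨b, z⟩ ⟨b', z'⟩ hne
  rw [Function.onFun, Set.disjoint_left]
  intro e he he'
  apply hne
  rw [hmemF] at he he'
  obtain ⟨p, hp, h1, h2, rfl⟩ := he
  obtain ⟨p', hp', h1', h2', he⟩ := he'
  dsimp only at he
  have hne1 := (hbase b p hp h1 h2).1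
  have hne2 := (hbase b' p' hp' h1' h2').1
  have hcc : orbitCode (f b ⟨p.1, h1⟩) (f b ⟨p.2, h2⟩) =
      orbitCode (f b' ⟨p'.1, h1'⟩) (f b' ⟨p'.2, h2'⟩) := by
    rw [← orbitCode_shiftSnd z, ← orbitCode_shiftSnd z' (f b' _)]
    rw [Sym2.eq_iff] at he
    rcases he with ⟨e1, e2⟩ | ⟨e1, e2⟩
    · rw [e1, e2]
    · rw [e1, e2, orbitCode_symm]
      exact hne2.symm
  rw [← hfcode, ← hfcode] at hcc
  -- Codes do not repeat across base blocks, so the block agrees; within a block they do not repeat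
  -- either, so the pair agrees. Freeness of the action then leaves only `z = z'`.
  have hbb : b = b' := by
    by_contra hbb
    have hpw := List.pairwise_iff_get.1 hdis.2
    rcases lt_or_gt_of_ne hbb with hlt | hlt
    · exact hpw b b' hlt (List.mem_map.2 ⟨p, hp, rfl⟩) (List.mem_map.2 ⟨p', hp', hcc.symm⟩)
    · exact hpw b' b hlt (List.mem_map.2 ⟨p', hp', rfl⟩) (List.mem_map.2 ⟨p, hp, hcc⟩)
  subst hbb
  have hpp : p = p' := List.inj_on_of_nodup_map (hdis.1 _ (List.get_mem blocks b)) hp hp' hcc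
  subst hpp
  congr 1
  rw [Sym2.eq_iff] at he
  rcases he with ⟨e1, -⟩ | ⟨e1, -⟩
  · simpa [shiftSnd] using e1
  · have h := congrArg Prod.fst e1
    exact (hne1 h).elim

/-! ### Triangles with pendant edges from cyclic differences -/

/-- The edges of a triangle on `0, 1, 2` with `p` pendant vertices attached to the vertex `0`. -/
def pendantTrianglePairs (p : ℕ) : List (ℕ × ℕ) :=
  [(0, 1), (0, 2), (1, 2)] ++ (List.range p).map fun i => (0, 3 + i)

section

variable {T W : Type*} {G : SimpleGraph W} {m : ℕ}

lemma BlowUpDecomposable.pendantTriangle {p : ℕ}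
    (h : BlowUpDecomposable G m (patternEdges (3 + p) (pendantTrianglePairs p)))
    {U : Finset T} (hU : U.card = p) {x y z : T} (hxy : x ≠ y) (hxz : x ≠ z) (hyz : y ≠ z)
    (hx : x ∉ U) (hy : y ∉ U) (hz : z ∉ U) :
    BlowUpDecomposable G m
      ({s(x, y), s(x, z), s(y, z)} ∪ (fun u => s(x, u)) '' (U : Set T)) := by
  let g : Fin p → T := fun i => (U.equivFinOfCardEq hU).symm i
  have hgU : ∀ i, g i ∈ U := fun i => ((U.equivFinOfCardEq hU).symm i).2
  have hg : Function.Injective g := Subtype.val_injective.comp (Equiv.injective _)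
  have hgs : ∀ u ∈ U, ∃ i, g i = u := fun u hu =>
    ⟨U.equivFinOfCardEq hU ⟨u, hu⟩, by simp [g]⟩
  have hf : Function.Injective (Fin.append ![x, y, z] g) := by
    rw [Fin.append_injective_iff]
    refine ⟨?_, hg, ?_⟩
    · intro i j hij
      fin_cases i <;> fin_cases j <;> simp_all
    · intro i j hij
      have := hgU j
      rw [← hij] at this
      fin_cases i
      exacts [hx this, hy this, hz this]
  convert h.image ⟨_, hf⟩ using 1
  have f0 : Fin.append ![x, y, z] g ⟨0, by omega⟩ = x := Fin.append_left ![x, y, z] g 0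
  have f1 : Fin.append ![x, y, z] g ⟨1, by omega⟩ = y := Fin.append_left ![x, y, z] g 1
  have f2 : Fin.append ![x, y, z] g ⟨2, by omega⟩ = z := Fin.append_left ![x, y, z] g 2
  have f3 : ∀ i (hi : i < p), Fin.append ![x, y, z] g ⟨3 + i, by omega⟩ = g ⟨i, hi⟩ :=
    fun i hi => Fin.append_right ![x, y, z] g ⟨i, hi⟩
  have hmem : ∀ e, e ∈ Sym2.map (Fin.append ![x, y, z] g) ''
      patternEdges (3 + p) (pendantTrianglePairs p) ↔
      ∃ q ∈ pendantTrianglePairs p, ∃ (h1 : q.1 < 3 + p) (h2 : q.2 < 3 + p),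
        e = s(Fin.append ![x, y, z] g ⟨q.1, h1⟩, Fin.append ![x, y, z] g ⟨q.2, h2⟩) := by
    intro e
    constructor
    · rintro ⟨e, ⟨q, hq, hqe⟩, rfl⟩
      have hlt : q.1 < 3 + p ∧ q.2 < 3 + p := by
        induction e with | _ a b =>
        have := a.2
        have := b.2
        simp only [Sym2.map_mk, Sym2.eq_iff] at hqe
        omega
      have he : e = s(⟨q.1, hlt.1⟩, ⟨q.2, hlt.2⟩) :=
        Sym2.map.injective Fin.val_injective (by rw [hqe]; rfl)
      exact ⟨q, hq, hlt.1, hlt.2, by rw [he]; rfl⟩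
    · rintro ⟨q, hq, h1, h2, rfl⟩
      exact ⟨s(⟨q.1, h1⟩, ⟨q.2, h2⟩), ⟨q, hq, rfl⟩, rfl⟩
  ext e
  refine Iff.trans ?_ (hmem e).symm
  simp only [Set.mem_union, Set.mem_insert_iff, Set.mem_singleton_iff, Set.mem_image,
    Finset.mem_coe, pendantTrianglePairs, List.mem_append, List.mem_cons, List.not_mem_nil,
    or_false, List.mem_map, List.mem_range]
  constructor
  · rintro ((rfl | rfl | rfl) | ⟨u, hu, rfl⟩)
    · exact ⟨(0, 1), by simp, by dsimp only; omega, by dsimp only; omega, by rw [f0, f1]⟩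
    · exact ⟨(0, 2), by simp, by dsimp only; omega, by dsimp only; omega, by rw [f0, f2]⟩
    · exact ⟨(1, 2), by simp, by dsimp only; omega, by dsimp only; omega, by rw [f1, f2]⟩
    · obtain ⟨⟨i, hi⟩, rfl⟩ := hgs u hu
      exact ⟨(0, 3 + i), Or.inr ⟨i, hi, rfl⟩, by dsimp only; omega, by simpa using hi,
        by rw [f0, f3 i hi]⟩
  · rintro ⟨q, (rfl | rfl | rfl) | ⟨i, hi, rfl⟩, h1, h2, rfl⟩
    · exact Or.inl (Or.inl (by rw [f0, f1]))
    · exact Or.inl (Or.inr (Or.inl (by rw [f0, f2])))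
    · exact Or.inl (Or.inr (Or.inr (by rw [f1, f2])))
    · exact Or.inr ⟨g ⟨i, hi⟩, hgU _, by rw [f0, f3 i hi]⟩

/-- Development of triangles with pendant edges in an abelian group: the edge `s(v z, nb z δ)` has
the "difference" `δ`, and the triangle of index `i` has the differences `a i`, `b i` and
`a i + b i`, its pendant edges those in `U i`. -/
lemma BlowUpDecomposable.of_differences {A ι : Type*} [AddCommGroupWithOne A]
    (hT : ∀ p ≤ 2, BlowUpDecomposable G m (patternEdges (3 + p) (pendantTrianglePairs p)))
    (v : A → T) (nb : A → ℕ → T) (D : Set ℕ) (a b : ι → ℕ) (U : ι → Finset ℕ)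
    (hinj : ∀ z, ∀ δ ∈ D, ∀ z', ∀ δ' ∈ D, s(v z, nb z δ) = s(v z', nb z' δ') → z = z' ∧ δ = δ')
    (hne : ∀ z, ∀ δ ∈ D, v z ≠ nb z δ)
    (ha : ∀ i z, nb z (a i) = v (z + a i)) (hb : ∀ i z, nb z (b i) = v (z + b i))
    (hab : ∀ i z, nb z (a i + b i) = v (z + (a i + b i : ℕ)))
    (hpos : ∀ i, 0 < a i ∧ 0 < b i ∧ a i ≠ b i) (hU : ∀ i, (U i).card ≤ 2)
    (hUab : ∀ i, ∀ δ ∈ U i, δ ≠ a i ∧ δ ≠ b i ∧ δ ≠ a i + b i)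
    (hD : ∀ δ, δ ∈ D ↔ ∃ i, δ = a i ∨ δ = b i ∨ δ = a i + b i ∨ δ ∈ U i)
    (hdisj : ∀ i j δ, (δ = a i ∨ δ = b i ∨ δ = a i + b i ∨ δ ∈ U i) →
      (δ = a j ∨ δ = b j ∨ δ = a j + b j ∨ δ ∈ U j) → i = j) :
    BlowUpDecomposable G m {e | ∃ z, ∃ δ ∈ D, e = s(v z, nb z δ)} := by
  classical
  -- The triangle of index (i, z) has vertices z, z + a, z + a + b under `v`; the pendant edges are
  -- at the vertex of z.
  let S : ι × A → Set (Sym2 T) := fun i =>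
    {s(v i.2, nb i.2 (a i.1)), s(v i.2, nb i.2 (a i.1 + b i.1)),
      s(nb i.2 (a i.1), nb i.2 (a i.1 + b i.1))} ∪
    (fun u => s(v i.2, u)) '' (((U i.1).image (nb i.2) : Finset T) : Set T)
  have hthird : ∀ i z, s(nb z (a i), nb z (a i + b i)) = s(v (z + a i), nb (z + a i) (b i)) := by
    intro i z
    rw [ha, hab, hb, Nat.cast_add, add_assoc]
  -- Each edge of the pendant triangle starts at z, except the one of difference b, which joins z +
  -- a to z + a + b and so starts at z + a. Thus each difference of index i occurs once per z, with
  -- a fixed shift.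
  have hS : ∀ i z e, e ∈ S (i, z) ↔ ∃ δ, (δ = a i ∨ δ = b i ∨ δ = a i + b i ∨ δ ∈ U i) ∧
      e = s(v (z + if δ = b i then (a i : A) else 0), nb (z + if δ = b i then (a i : A) else 0) δ) := by
    intro i z e
    obtain ⟨h1, h2, h3⟩ := hpos i
    simp only [S, Set.mem_union, Set.mem_insert_iff, Set.mem_singleton_iff, Set.mem_image,
      Finset.mem_coe, Finset.mem_image, hthird]
    constructor
    · rintro ((rfl | rfl | rfl) | ⟨_, ⟨δ, hδ, rfl⟩, rfl⟩)
      · exact ⟨a i, by simp, by simp [h3]⟩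
      · exact ⟨a i + b i, by simp, by simp [h1.ne']⟩
      · exact ⟨b i, by simp, by simp⟩
      · exact ⟨δ, by simp [hδ], by simp [(hUab i δ hδ).2.1]⟩
    · rintro ⟨δ, rfl | rfl | rfl | hδ, rfl⟩
      · left; simp [h3]
      · left; simp
      · left; simp [h1.ne']
      · exact Or.inr ⟨_, ⟨δ, hδ, rfl⟩, by simp [(hUab i δ hδ).2.1]⟩
  have hunion : {e | ∃ z, ∃ δ ∈ D, e = s(v z, nb z δ)} = ⋃ i, S i := by
    ext e
    simp only [Set.mem_iUnion, Prod.exists, hS]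
    constructor
    · rintro ⟨z, δ, hδ, rfl⟩
      obtain ⟨i, hi⟩ := (hD δ).1 hδ
      exact ⟨i, z - if δ = b i then (a i : A) else 0, δ, hi, by rw [sub_add_cancel]⟩
    · rintro ⟨i, z, δ, hi, rfl⟩
      exact ⟨_, δ, (hD δ).2 ⟨i, hi⟩, rfl⟩
  rw [hunion]
  refine BlowUpDecomposable.iUnion ?_ ?_
  · rintro ⟨i, z⟩ ⟨j, w⟩ hij
    rw [Function.onFun, Set.disjoint_left]
    intro e he he'
    apply hij
    rw [hS] at he he'
    obtain ⟨δ, hδ, rfl⟩ := he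
    obtain ⟨δ', hδ', he⟩ := he'
    obtain ⟨h1, rfl⟩ := hinj _ δ ((hD δ).2 ⟨i, hδ⟩) _ δ' ((hD δ').2 ⟨j, hδ'⟩) he
    obtain rfl := hdisj i j δ hδ hδ'
    rw [add_left_inj] at h1
    rw [h1]
  · rintro ⟨i, z⟩
    have hmemD : ∀ δ, (δ = a i ∨ δ = b i ∨ δ = a i + b i ∨ δ ∈ U i) → δ ∈ D :=
      fun δ h => (hD δ).2 ⟨i, h⟩
    have hnbinj : ∀ δ δ', (δ = a i ∨ δ = b i ∨ δ = a i + b i ∨ δ ∈ U i) →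
        (δ' = a i ∨ δ' = b i ∨ δ' = a i + b i ∨ δ' ∈ U i) → nb z δ = nb z δ' → δ = δ' :=
      fun δ δ' h h' he => (hinj z δ (hmemD δ h) z δ' (hmemD δ' h') (by rw [he])).2
    obtain ⟨h1, h2, h3⟩ := hpos i
    have hcard : ((U i).image (nb z)).card = (U i).card :=
      Finset.card_image_of_injOn fun δ hδ δ' hδ' h =>
        hnbinj δ δ' (by simp [Finset.mem_coe.1 hδ]) (by simp [Finset.mem_coe.1 hδ']) h
    refine BlowUpDecomposable.pendantTriangle (hT _ (hU i)) hcard (hne z _ (hmemD _ (by simp)))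
      (hne z _ (hmemD _ (by simp))) ?_ ?_ ?_ ?_
    · intro h
      have := hnbinj _ _ (by simp) (by simp) h
      dsimp only at this
      omega
    all_goals
      rw [Finset.mem_image]
      rintro ⟨δ, hδ, h⟩
    · exact hne z δ (hmemD δ (by simp [hδ])) h.symm
    · exact (hUab i δ hδ).1 (hnbinj _ _ (by simp [hδ]) (by simp) h)
    · exact (hUab i δ hδ).2.2 (hnbinj _ _ (by simp [hδ]) (by simp) h)

end

/-- Modulo 2n+1 each nonzero class is d or -d for exactly one d in 1, …, n. The reversed orientation
would need 2n+1 to divide d + d', which lies between 1 and 2n. -/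
lemma ZMod.sym2_add_natCast_inj {n : ℕ} {z z' : ZMod (2 * n + 1)} {d d' : ℕ} (hd : 0 < d)
    (hdn : d ≤ n) (hdn' : d' ≤ n)
    (h : s(z, z + (d : ZMod (2 * n + 1))) = s(z', z' + (d' : ZMod (2 * n + 1)))) : z = z' ∧ d = d' := by
  rw [Sym2.eq_iff] at h
  rcases h with ⟨rfl, h⟩ | ⟨rfl, h⟩
  · refine ⟨rfl, ?_⟩
    rw [add_right_inj, ZMod.natCast_eq_natCast_iff'] at h
    rwa [Nat.mod_eq_of_lt (by omega), Nat.mod_eq_of_lt (by omega)] at h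
  · rw [add_assoc, add_eq_left, ← Nat.cast_add, ZMod.natCast_eq_zero_iff] at h
    have := Nat.le_of_dvd (by omega) h
    omega

lemma ZMod.exists_sym2_eq_add_natCast {n : ℕ} {x y : ZMod (2 * n + 1)} (h : x ≠ y) :
    ∃ z, ∃ d : ℕ, 0 < d ∧ d ≤ n ∧ s(x, y) = s(z, z + (d : ZMod (2 * n + 1))) := by
  have hpos : ∀ {x y : ZMod (2 * n + 1)}, x ≠ y → 0 < (y - x).val := fun h => by
    rw [Nat.pos_iff_ne_zero, ne_eq, ZMod.val_eq_zero, sub_eq_zero]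
    exact h.symm
  by_cases hd : (y - x).val ≤ n
  · exact ⟨x, (y - x).val, hpos h, hd, by simp⟩
  · refine ⟨y, (x - y).val, hpos h.symm, ?_, by simp [Sym2.eq_swap]⟩
    have : NeZero (y - x) := ⟨sub_ne_zero.2 h.symm⟩
    rw [← neg_sub, ZMod.val_neg_of_ne_zero]
    omega

section

variable {W : Type*} {G : SimpleGraph W} {m : ℕ}

/-- The differences in `D` of the pendant edges at the `i`-th of `k` triangles, where the difference
`0` stands for the edges to a fixed point. -/
def pendantDifferences (D : Finset ℕ) (k i : ℕ) : Finset ℕ :=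
  ({if i = k then 0 else 2 * i, 4 * k - 1 + i} : Finset ℕ) ∩ D

/-- With k = ⌊(n+1)/4⌋, the triangles i = 1, …, k have differences 2i-1, 3k-i and their sum 3k+i-1.
These fill the odd numbers below 2k and the intervals [2k, 3k) and [3k, 4k). The remaining
differences become pendant edges: 2i for i < k, and 4k, …, n as 4k-1+i. Since 2k is already used,
the index i = k is free to take 0, if it occurs. As n ≤ 4k+2, the pendant edges suffice once 4k+2 ≤
5k-1, that is k ≥ 3, which is why 11 ≤ n is required. -/
lemma BlowUpDecomposable.nonDiag_of_differences {A T : Type*} [AddCommGroupWithOne A]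
    (hT : ∀ p ≤ 2, BlowUpDecomposable G m (patternEdges (3 + p) (pendantTrianglePairs p)))
    {n : ℕ} (hn : 11 ≤ n) (D : Finset ℕ) (hDn : ∀ δ ∈ D, δ ≤ n) (hD : ∀ δ, 0 < δ → δ ≤ n → δ ∈ D)
    (v : A → T) (nb : A → ℕ → T)
    (hinj : ∀ z, ∀ δ ∈ D, ∀ z', ∀ δ' ∈ D, s(v z, nb z δ) = s(v z', nb z' δ') → z = z' ∧ δ = δ')
    (hne : ∀ z, ∀ δ ∈ D, v z ≠ nb z δ) (hnb : ∀ z, ∀ δ, 0 < δ → nb z δ = v (z + δ))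
    (hsurj : ∀ x y : T, x ≠ y → ∃ z, ∃ δ ∈ D, s(x, y) = s(v z, nb z δ)) :
    BlowUpDecomposable G m (nonDiag T) := by
  have hnd : nonDiag T = {e | ∃ z, ∃ δ ∈ (D : Set ℕ), e = s(v z, nb z δ)} := by
    ext e
    induction e with | _ x y =>
    rw [mk_mem_nonDiag]
    refine ⟨hsurj x y, ?_⟩
    rintro ⟨z, δ, hδ, h⟩ rfl
    have : (s(x, x)).IsDiag := by simp
    rw [h, Sym2.mk_isDiag_iff] at this
    exact hne z δ hδ this
  rw [hnd]
  -- This k satisfies 4k-1 ≤ n ≤ 4k+2.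
  obtain ⟨k, hk⟩ : ∃ k, k = (n + 1) / 4 := ⟨_, rfl⟩
  have hU : ∀ i δ, δ ∈ pendantDifferences D k i ↔
      ((i = k ∧ δ = 0 ∨ i ≠ k ∧ δ = 2 * i) ∨ δ = 4 * k - 1 + i) ∧ δ ∈ D := by
    intro i δ
    simp only [pendantDifferences, Finset.mem_inter, Finset.mem_insert, Finset.mem_singleton]
    by_cases h : i = k <;> simp [h]
  refine BlowUpDecomposable.of_differences (ι := {i : ℕ // 1 ≤ i ∧ i ≤ k}) hT v nb D
    (fun i => 2 * i - 1) (fun i => 3 * k - i) (fun i => pendantDifferences D k i) hinj hne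
    ?_ ?_ ?_ ?_ ?_ ?_ ?_ ?_
  · rintro ⟨i, h1, h2⟩ z
    exact hnb z _ (by dsimp only; omega)
  · rintro ⟨i, h1, h2⟩ z
    exact hnb z _ (by dsimp only; omega)
  · rintro ⟨i, h1, h2⟩ z
    exact hnb z _ (by dsimp only; omega)
  · rintro ⟨i, h1, h2⟩
    dsimp only
    omega
  · intro i
    exact (Finset.card_le_card Finset.inter_subset_left).trans Finset.card_le_two
  · rintro ⟨i, h1, h2⟩ δ hδ
    obtain ⟨hδ, hδD⟩ := (hU i δ).1 hδ
    dsimp only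
    omega
  · intro δ
    rw [Finset.mem_coe]
    constructor
    · intro hδ
      have hle := hDn δ hδ
      by_cases h0 : δ = 0
      · exact ⟨⟨k, by omega⟩, by simp only [hU]; simp [h0, h0 ▸ hδ]⟩
      by_cases h1 : 4 * k ≤ δ
      · refine ⟨⟨δ - (4 * k - 1), by omega⟩, ?_⟩
        simp only [hU, hδ, and_true]
        omega
      by_cases h2 : 3 * k ≤ δ
      · refine ⟨⟨δ + 1 - 3 * k, by omega⟩, ?_⟩
        simp only [hU, hδ, and_true]
        omega
      by_cases h3 : 2 * k ≤ δ
      · refine ⟨⟨3 * k - δ, by omega⟩, ?_⟩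
        simp only [hU, hδ, and_true]
        omega
      · refine ⟨⟨(δ + 1) / 2, by omega⟩, ?_⟩
        simp only [hU, hδ, and_true]
        omega
    · rintro ⟨⟨i, h1, h2⟩, h | h | h | h⟩
      · exact hD δ (by dsimp only at h; omega) (by dsimp only at h; omega)
      · exact hD δ (by dsimp only at h; omega) (by dsimp only at h; omega)
      · exact hD δ (by dsimp only at h; omega) (by dsimp only at h; omega)
      · exact ((hU i δ).1 h).2
  · rintro ⟨i, h1, h2⟩ ⟨j, h3, h4⟩ δ h h'
    simp only [hU] at h h'
    rw [Subtype.mk.injEq]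
    have : δ ∈ D → δ ≤ n := hDn δ
    omega

/-- For odd s = 2n+1 the vertices are the integers modulo 2n+1; for even s = 2n+2 a point at
infinity is added, whose edges form the difference 0. The bound 23 = 2·11+1 corresponds to n ≥ 11.
-/
lemma blowUpDecomposable_nonDiag_of_large
    (hT : ∀ p ≤ 2, BlowUpDecomposable G m (patternEdges (3 + p) (pendantTrianglePairs p)))
    {s : ℕ} (hs : 23 ≤ s) : BlowUpDecomposable G m (nonDiag (Fin s)) := by
  rcases Nat.even_or_odd' s with ⟨c, rfl | rfl⟩
  · obtain ⟨n, rfl⟩ : ∃ n, c = n + 1 := ⟨c - 1, by omega⟩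
    have h : BlowUpDecomposable G m (nonDiag (Option (ZMod (2 * n + 1)))) := by
      refine BlowUpDecomposable.nonDiag_of_differences (A := ZMod (2 * n + 1)) hT (n := n)
        (by omega) (Finset.range (n + 1)) (fun _ h => by rw [Finset.mem_range] at h; omega)
        (fun _ _ h => by rw [Finset.mem_range]; omega) some
        (fun z δ => if δ = 0 then none else some (z + δ)) ?_ ?_ ?_ ?_
      · intro z δ hδ z' δ' hδ' h
        rw [Finset.mem_range] at hδ hδ'
        by_cases h0 : δ = 0 <;> by_cases h0' : δ' = 0 <;> simp only [h0, h0', if_true, if_false] at h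
        · simp_all
        · simp at h
        · simp at h
        · have h' : Sym2.map some s(z, z + δ) = Sym2.map some s(z', z' + δ') := h
          exact ZMod.sym2_add_natCast_inj (by omega) (by omega) (by omega)
            (Sym2.map.injective (Option.some_injective _) h')
      · intro z δ hδ
        rw [Finset.mem_range] at hδ
        split_ifs
        · simp
        · rw [ne_eq, Option.some.injEq, left_eq_add, ZMod.natCast_eq_zero_iff]
          intro h
          have := Nat.le_of_dvd (by omega) h
          omega
      · intro z δ hδ
        simp [hδ.ne']
      · rintro (_ | x) (_ | y) hxy
        · exact (hxy rfl).elim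
        · exact ⟨y, 0, by simp, by simp [Sym2.eq_swap]⟩
        · exact ⟨x, 0, by simp, by simp⟩
        · obtain ⟨z, d, hd, hdn, h⟩ := ZMod.exists_sym2_eq_add_natCast
            (fun h : x = y => hxy (congrArg some h))
          refine ⟨z, d, by simp; omega, ?_⟩
          rw [if_neg hd.ne']
          exact congrArg (Sym2.map some) h
    refine h.nonDiag_congr (Fintype.equivOfCardEq ?_)
    simp [ZMod.card]
    ring
  · have h : BlowUpDecomposable G m (nonDiag (ZMod (2 * c + 1))) := by
      refine BlowUpDecomposable.nonDiag_of_differences (A := ZMod (2 * c + 1)) hT (n := c)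
        (by omega) (Finset.Icc 1 c) (by simp) (by simp; omega) id (fun z δ => z + δ) ?_ ?_ ?_ ?_
      · intro z δ hδ z' δ' hδ' h
        rw [Finset.mem_Icc] at hδ hδ'
        exact ZMod.sym2_add_natCast_inj hδ.1 hδ.2 hδ'.2 h
      · intro z δ hδ
        rw [Finset.mem_Icc] at hδ
        rw [ne_eq, id, left_eq_add, ZMod.natCast_eq_zero_iff]
        intro h
        have := Nat.le_of_dvd (by omega) h
        omega
      · intros; rfl
      · intro x y hxy
        obtain ⟨z, d, hd, hdn, h⟩ := ZMod.exists_sym2_eq_add_natCast hxy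
        exact ⟨z, d, by simp; omega, h⟩
    refine h.nonDiag_congr (Fintype.equivOfCardEq ?_)
    simp [ZMod.card]

end

/-! ### Edge lists of theta graphs and splittings of small complete graphs -/

/-- The edges of `thetaGraph a b c`. -/
def thetaPairs (a b c : ℕ) : List (ℕ × ℕ) :=
  ((List.range a).map fun i => (thetaPathVertex a 1 i, thetaPathVertex a 1 (i + 1))) ++
  ((List.range b).map fun i => (thetaPathVertex b a i, thetaPathVertex b a (i + 1))) ++
  (List.range c).map fun i =>
    (thetaPathVertex c (a + b - 1) i, thetaPathVertex c (a + b - 1) (i + 1))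

/-- Loops have to be excluded, since `SimpleGraph.fromRel` discards them whereas the edge list would
keep them. -/
lemma edgeSet_thetaGraph {a b c : ℕ} (h : ∀ p ∈ thetaPairs a b c, p.1 ≠ p.2) :
    (thetaGraph a b c).edgeSet = patternEdges (a + b + c - 1) (thetaPairs a b c) := by
  have hmem : ∀ u v : ℕ, (u, v) ∈ thetaPairs a b c ↔
      (∃ i < a, u = thetaPathVertex a 1 i ∧ v = thetaPathVertex a 1 (i + 1)) ∨
      (∃ i < b, u = thetaPathVertex b a i ∧ v = thetaPathVertex b a (i + 1)) ∨
      (∃ i < c, u = thetaPathVertex c (a + b - 1) i ∧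
        v = thetaPathVertex c (a + b - 1) (i + 1)) := by
    intro u v
    simp only [thetaPairs, List.mem_append, List.mem_map, List.mem_range, Prod.mk.injEq, or_assoc,
      eq_comm (b := u), eq_comm (b := v)]
  ext e
  induction e with | _ x y =>
  rw [SimpleGraph.mem_edgeSet, thetaGraph, SimpleGraph.fromRel_adj, ← hmem, ← hmem]
  constructor
  · rintro ⟨-, hxy | hxy⟩
    · exact ⟨_, hxy, rfl⟩
    · exact ⟨_, hxy, Sym2.eq_swap⟩
  · rintro ⟨⟨u, v⟩, hp, hxy⟩
    have hne := h _ hp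
    simp only [Sym2.map_mk, Sym2.eq_iff] at hxy
    rcases hxy with ⟨rfl, rfl⟩ | ⟨rfl, rfl⟩
    · exact ⟨fun hxy => hne (congrArg Fin.val hxy), Or.inl hp⟩
    · exact ⟨fun hxy => hne (congrArg Fin.val hxy.symm), Or.inr hp⟩

instance (a b c : ℕ) : DecidableRel (thetaGraph a b c).Adj := fun u v =>
  inferInstanceAs (Decidable (u ≠ v ∧ (_ ∨ _)))

section

variable {W : Type*} {G : SimpleGraph W} {m : ℕ}

lemma BlowUpDecomposable.of_checkPartition {s : ℕ} {blocks : List (List ℕ)}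
    (pat : ℕ → List (ℕ × ℕ))
    (hpat : ∀ B ∈ blocks, BlowUpDecomposable G m (patternEdges B.length (pat B.length)))
    (h : checkPartition s (completePairs s) (blocks.map fun B => (B, pat B.length)) = true) :
    BlowUpDecomposable G m (nonDiag (Fin s)) := by
  rw [← patternEdges_completePairs]
  refine checkPartition_sound h (BlowUpDecomposable G m)
    (fun S hd hS => BlowUpDecomposable.iUnion hd hS) ?_
  intro it hit f
  obtain ⟨B, hB, rfl⟩ := List.mem_map.1 hit
  exact (hpat B hB).image f

lemma EdgeDecomposable.of_checkPartition {s w : ℕ} {G : SimpleGraph (Fin w)} {E : List (ℕ × ℕ)}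
    (hG : G.edgeSet = patternEdges w E) {blocks : List (List ℕ)}
    (hw : blocks.all (fun B => B.length == w) = true)
    (h : checkPartition s (completePairs s) (blocks.map (·, E)) = true) :
    EdgeDecomposable G (nonDiag (Fin s)) := by
  rw [← patternEdges_completePairs]
  refine checkPartition_sound h (EdgeDecomposable G) (fun S hd hS => EdgeDecomposable.iUnion hd hS)
    ?_
  intro it hit f
  obtain ⟨B, hB, rfl⟩ := List.mem_map.1 hit
  simp only [List.all_eq_true, beq_iff_eq] at hw
  obtain rfl := hw B hB
  dsimp only
  rw [← hG]
  exact EdgeDecomposable.copy f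

/-- Triangles with at most two pendant edges that partition the edges of the complete graph on `s`
vertices. -/
def smallTriangleBlocks : ℕ → List (List ℕ)
  | 6 => develop 3 2 [[4, 0, 2, 5, 1]]
  | 7 => develop 7 1 [[2, 5, 4]]
  -- Labels from k * r on are fixed by `blockTranslate`, so 7 is here a point at infinity over the
  -- integers modulo 7. The first vertex of a block carries the pendant edges.
  | 8 => develop 7 1 [[2, 6, 1, 7]]
  | 9 => develop 9 1 [[7, 4, 3, 5]]
  | 10 => develop 9 1 [[1, 8, 4, 9, 2]]
  | 11 => develop 11 1 [[6, 5, 2, 0, 4]]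
  | 12 => develop 3 4 [[2, 0, 6, 9], [8, 6, 5, 9], [8, 3, 10, 0, 11], [2, 5, 4, 3, 10],
      [10, 5, 11, 1]]
  | 13 => develop 13 1 [[5, 11, 3], [4, 8, 7]]
  | 14 => develop 13 1 [[6, 4, 11], [6, 3, 7, 13]]
  | 15 => develop 15 1 [[7, 2, 14], [13, 2, 11, 14]]
  | 16 => develop 15 1 [[8, 3, 6], [11, 3, 12, 7, 15]]
  | 17 => develop 17 1 [[14, 5, 16], [9, 13, 6, 4, 8]]
  | 18 => develop 17 1 [[13, 11, 10, 1], [9, 13, 3, 0, 17]]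
  | 19 => develop 19 1 [[15, 9, 5, 16, 7], [1, 3, 8, 4]]
  | 20 => develop 19 1 [[2, 12, 13, 6, 14], [7, 12, 9, 13, 19]]
  | 21 => develop 21 1 [[3, 10, 6, 1, 19], [11, 20, 12, 0, 17]]
  | 22 => develop 21 1 [[1, 6, 3, 21], [1, 9, 15], [3, 13, 4, 7]]
  | _ => []

lemma smallTriangleBlocks_check : ∀ s < 17,
    (∀ B ∈ smallTriangleBlocks (s + 6), B.length = 3 ∨ B.length = 4 ∨ B.length = 5) ∧
    checkPartition (s + 6) (completePairs (s + 6)) ((smallTriangleBlocks (s + 6)).map fun B =>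
      (B, pendantTrianglePairs (B.length - 3))) = true := by
  decide +kernel

/-- The bound 6 is needed: K_2, K_4 and K_5 have no partition into triangles with at most two
pendant edges at one vertex. -/
lemma blowUpDecomposable_nonDiag
    (hT : ∀ p ≤ 2, BlowUpDecomposable G m (patternEdges (3 + p) (pendantTrianglePairs p)))
    {s : ℕ} (hs : 6 ≤ s) : BlowUpDecomposable G m (nonDiag (Fin s)) := by
  rcases lt_or_ge s 23 with h | h
  · obtain ⟨s, rfl⟩ := Nat.exists_eq_add_of_le' hs
    obtain ⟨h1, h2⟩ := smallTriangleBlocks_check s (by omega)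
    refine BlowUpDecomposable.of_checkPartition (fun l => pendantTrianglePairs (l - 3)) ?_ h2
    intro B hB
    rcases h1 B hB with h | h | h <;> rw [h]
    exacts [hT 0 (by omega), hT 1 (by omega), hT 2 (by omega)]
  · exact blowUpDecomposable_nonDiag_of_large hT h

/-- A pairwise balanced design of order `10` with block sizes `3` and `4`. -/
def pairwiseBalancedTen : List (List ℕ) :=
  [[0, 1, 2, 3], [0, 4, 5, 6], [0, 7, 8, 9], [1, 4, 7], [1, 5, 8], [1, 6, 9], [2, 4, 8],
    [2, 5, 9], [2, 6, 7], [3, 4, 9], [3, 5, 7], [3, 6, 8]]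

/-- A pairwise balanced design of order `11` with block sizes `3` and `5`. -/
def pairwiseBalancedEleven : List (List ℕ) :=
  [[0, 1, 2, 3, 4], [0, 10, 5], [0, 6, 9], [0, 7, 8], [1, 10, 6], [1, 7, 5], [1, 8, 9],
    [2, 10, 7], [2, 8, 6], [2, 9, 5], [3, 10, 8], [3, 9, 7], [3, 5, 6], [4, 10, 9], [4, 5, 8],
    [4, 6, 7]]

lemma pairwiseBalancedTen_check :
    (∀ B ∈ pairwiseBalancedTen, B.length = 3 ∨ B.length = 4 ∨ B.length = 5) ∧
    checkPartition 10 (completePairs 10)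
      (pairwiseBalancedTen.map fun B => (B, completePairs B.length)) = true := by
  decide +kernel

lemma pairwiseBalancedEleven_check :
    (∀ B ∈ pairwiseBalancedEleven, B.length = 3 ∨ B.length = 4 ∨ B.length = 5) ∧
    checkPartition 11 (completePairs 11)
      (pairwiseBalancedEleven.map fun B => (B, completePairs B.length)) = true := by
  decide +kernel

/-! ### Filling the groups of a blow-up -/

/-- The embedding of `Option M` in `Option (T × M)` with first coordinate `x`. -/
def optionSlice {T M : Type*} (x : T) : Option M ↪ Option (T × M) :=
  (Function.Embedding.sectR x M).optionMap

/-- An edge either joins points over different elements of T or lies in a single slice, a group with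
the extra point `none` added. Two slices share only that point, so they have no common edge. -/
lemma nonDiag_option_prod (T M : Type*) :
    nonDiag (Option (T × M)) = Sym2.map some '' (Sym2.map Prod.fst ⁻¹' nonDiag T) ∪
      ⋃ x : T, Sym2.map (optionSlice x) '' nonDiag (Option M) := by
  ext e
  constructor
  · induction e with | _ x y =>
    rw [mk_mem_nonDiag]
    intro hxy
    rcases x with _ | ⟨x, i⟩ <;> rcases y with _ | ⟨y, j⟩
    · exact (hxy rfl).elim
    · exact Or.inr (Set.mem_iUnion.2 ⟨y, s(none, some j), by simp, by simp [optionSlice]⟩)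
    · exact Or.inr (Set.mem_iUnion.2 ⟨x, s(some i, none), by simp, by simp [optionSlice]⟩)
    · by_cases h : x = y
      · subst h
        refine Or.inr (Set.mem_iUnion.2 ⟨x, s(some i, some j), ?_, by simp [optionSlice]⟩)
        simpa using hxy
      · exact Or.inl ⟨s((x, i), (y, j)), by simpa using h, rfl⟩
  · rintro (⟨e, he, rfl⟩ | he)
    · induction e with | _ x y =>
      simp only [Set.mem_preimage, Sym2.map_mk, mk_mem_nonDiag] at he
      rw [Sym2.map_mk, mk_mem_nonDiag]
      exact fun h => he (congrArg Prod.fst (Option.some_injective _ h))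
    · obtain ⟨x, e, hij, rfl⟩ := Set.mem_iUnion.1 he
      induction e with | _ i j =>
      rw [mk_mem_nonDiag] at hij
      rw [Sym2.map_mk, mk_mem_nonDiag]
      exact (optionSlice x).injective.ne hij

lemma disjoint_optionSlice {T M : Type*} {x y : T} (h : x ≠ y) :
    Disjoint (Sym2.map (optionSlice x) '' nonDiag (Option M))
      (Sym2.map (optionSlice y) '' nonDiag (Option M)) := by
  rw [Set.disjoint_left]
  rintro _ ⟨e, he, rfl⟩ ⟨e', he', h'⟩
  induction e with | _ i j =>
  induction e' with | _ i' j' =>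
  rcases i with _ | i <;> rcases j with _ | j <;> rcases i' with _ | i' <;> rcases j' with _ | j' <;>
    simp_all [optionSlice, eq_comm]

lemma disjoint_some_optionSlice (T M : Type*) :
    Disjoint (Sym2.map some '' (Sym2.map Prod.fst ⁻¹' nonDiag T))
      (⋃ x : T, Sym2.map (optionSlice x) '' nonDiag (Option M)) := by
  rw [Set.disjoint_left]
  rintro _ ⟨e, he, rfl⟩ he'
  obtain ⟨x, e', he', h⟩ := Set.mem_iUnion.1 he'
  induction e with | _ i j =>
  induction e' with | _ i' j' =>
  simp only [Set.mem_preimage, Sym2.map_mk, mk_mem_nonDiag] at he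
  rcases i' with _ | i' <;> rcases j' with _ | j' <;>
    simp [optionSlice] at h
  rcases h with ⟨rfl, rfl⟩ | ⟨rfl, rfl⟩ <;> exact he rfl

lemma EdgeDecomposable.fill_option {T : Type*} (h : BlowUpDecomposable G m (nonDiag T))
    (hm : EdgeDecomposable G (nonDiag (Fin (m + 1)))) :
    EdgeDecomposable G (nonDiag (Option (T × Fin m))) := by
  rw [nonDiag_option_prod]
  exact (EdgeDecomposable.image h Function.Embedding.some).union (disjoint_some_optionSlice _ _)
    (EdgeDecomposable.iUnion (fun x y hxy => disjoint_optionSlice hxy) fun x =>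
      (hm.nonDiag_congr (finSuccEquiv m)).image _)

lemma EdgeDecomposable.fill {T : Type*} (h : BlowUpDecomposable G m (nonDiag T))
    (hm : EdgeDecomposable G (nonDiag (Fin m))) : EdgeDecomposable G (nonDiag (T × Fin m)) := by
  have hset : nonDiag (T × Fin m) = (Sym2.map Prod.fst ⁻¹' nonDiag T) ∪
      ⋃ x : T, Sym2.map (Function.Embedding.sectR x (Fin m)) '' nonDiag (Fin m) := by
    ext e
    constructor
    · induction e with | _ x y =>
      rw [mk_mem_nonDiag]
      intro hxy
      rcases x with ⟨x, i⟩
      rcases y with ⟨y, j⟩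
      by_cases h : x = y
      · subst h
        exact Or.inr (Set.mem_iUnion.2 ⟨x, s(i, j), by simpa using hxy, by simp⟩)
      · exact Or.inl (by simpa using h)
    · rintro (he | he)
      · induction e with | _ x y =>
        simp only [Set.mem_preimage, Sym2.map_mk, mk_mem_nonDiag] at he
        exact mk_mem_nonDiag.2 fun h => he (congrArg Prod.fst h)
      · obtain ⟨x, e, hij, rfl⟩ := Set.mem_iUnion.1 he
        induction e with | _ i j =>
        rw [mk_mem_nonDiag] at hij
        exact mk_mem_nonDiag.2 ((Function.Embedding.sectR x (Fin m)).injective.ne hij)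
  rw [hset]
  refine EdgeDecomposable.union ?_ h (EdgeDecomposable.iUnion ?_ fun x => hm.image _)
  · rw [Set.disjoint_left]
    intro e he he'
    obtain ⟨x, e, -, rfl⟩ := Set.mem_iUnion.1 he'
    induction e with | _ i j => simp at he
  · intro x y hxy
    rw [Function.onFun, Set.disjoint_left]
    rintro _ ⟨e, -, rfl⟩ ⟨e', -, h'⟩
    induction e with | _ i j =>
    induction e' with | _ i' j' =>
    simp only [Function.Embedding.sectR_apply, Sym2.map_mk, Sym2.eq_iff, Prod.mk.injEq] at h'
    rcases h' with ⟨h', -⟩ | ⟨h', -⟩ <;> exact hxy h'.1.symm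

lemma BlowUpDecomposable.of_mul {T : Type*} {a b : ℕ} {P : Set (Sym2 T)}
    (h : BlowUpDecomposable G (a * b) P) :
    BlowUpDecomposable G b (Sym2.map Prod.fst ⁻¹' P : Set (Sym2 (T × Fin a))) := by
  let φ : T × Fin (a * b) ≃ (T × Fin a) × Fin b :=
    ((Equiv.refl T).prodCongr finProdFinEquiv.symm).trans (Equiv.prodAssoc _ _ _).symm
  have hφ : ∀ x, (φ.symm x).1 = x.1.1 := fun x => rfl
  unfold BlowUpDecomposable
  convert EdgeDecomposable.image h φ.toEmbedding
  ext e
  induction e with | _ x y =>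
  constructor
  · intro he
    exact ⟨s(φ.symm x, φ.symm y), by simpa [hφ] using he, by simp⟩
  · rintro ⟨e, he, hxy⟩
    induction e with | _ x' y' =>
    rw [← hxy]
    exact he

/-- Doubling each vertex of T and adding one point leaves, besides the doubled complete graph, one
triangle for each element of T, formed by its two copies and the new point. Blowing up by 2 and then
by m is blowing up by 2m. -/
lemma BlowUpDecomposable.option_prod {T : Type*} (h : BlowUpDecomposable G (2 * m) (nonDiag T))
    (h3 : BlowUpDecomposable G m (nonDiag (Fin 3))) :
    BlowUpDecomposable G m (nonDiag (Option (T × Fin 2))) := by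
  rw [nonDiag_option_prod]
  exact (h.of_mul.image Function.Embedding.some).union (disjoint_some_optionSlice _ _)
    (BlowUpDecomposable.iUnion (fun x y hxy => disjoint_optionSlice hxy) fun x =>
      (h3.nonDiag_congr (finSuccEquiv 2)).image _)

lemma BlowUpDecomposable.of_subsingleton {T : Type*} [Subsingleton T] :
    BlowUpDecomposable G m (nonDiag T) := by
  have : nonDiag T = ∅ := by
    ext e
    induction e with | _ x y => simp [Subsingleton.elim x y]
  rw [this]
  exact EdgeDecomposable.empty

/-! ### The recursion giving all orders -/

/-- The decompositions from which those of all complete graphs are built. -/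
structure BaseDecompositions (G : SimpleGraph W) : Prop where
  complete11 : EdgeDecomposable G (nonDiag (Fin 11))
  complete12 : EdgeDecomposable G (nonDiag (Fin 12))
  complete22 : EdgeDecomposable G (nonDiag (Fin 22))
  complete23 : EdgeDecomposable G (nonDiag (Fin 23))
  blowUp11 : ∀ t, t = 3 ∨ t = 4 ∨ t = 5 → BlowUpDecomposable G 11 (patternEdges t (completePairs t))
  blowUp22 : ∀ p ≤ 2, BlowUpDecomposable G 22 (patternEdges (3 + p) (pendantTrianglePairs p))
  blowUp22_four : BlowUpDecomposable G 22 (patternEdges 4 (completePairs 4))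

namespace BaseDecompositions

lemma hasDesign_of_blowUp11 (h : BaseDecompositions G) {t n : ℕ}
    (ht : BlowUpDecomposable G 11 (nonDiag (Fin t))) (hn : n = t * 11 ∨ n = t * 11 + 1) :
    HasDesign G n := by
  rcases hn with rfl | rfl
  · exact ((EdgeDecomposable.fill ht h.complete11).nonDiag_congr finProdFinEquiv).hasDesign
  · exact ((EdgeDecomposable.fill_option ht h.complete12).nonDiag_congr
      (finProdFinEquiv.optionCongr.trans (finSuccEquiv _).symm)).hasDesign

lemma hasDesign_of_blowUp22 (h : BaseDecompositions G) {t n : ℕ}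
    (ht : BlowUpDecomposable G 22 (nonDiag (Fin t))) (hn : n = t * 22 ∨ n = t * 22 + 1) :
    HasDesign G n := by
  rcases hn with rfl | rfl
  · exact ((EdgeDecomposable.fill ht h.complete22).nonDiag_congr finProdFinEquiv).hasDesign
  · exact ((EdgeDecomposable.fill_option ht h.complete23).nonDiag_congr
      (finProdFinEquiv.optionCongr.trans (finSuccEquiv _).symm)).hasDesign

lemma blowUp22_nonDiag (h : BaseDecompositions G) {s : ℕ} (h2 : s ≠ 2) (h5 : s ≠ 5) :
    BlowUpDecomposable G 22 (nonDiag (Fin s)) := by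
  rcases lt_or_ge s 6 with hs | hs
  · have : s = 0 ∨ s = 1 ∨ s = 3 ∨ s = 4 := by omega
    rcases this with rfl | rfl | rfl | rfl
    · exact .of_subsingleton
    · exact .of_subsingleton
    · rw [← patternEdges_completePairs]
      -- `completePairs 3` and `pendantTrianglePairs 0` evaluate to the same list.
      exact h.blowUp22 0 (by omega)
    · rw [← patternEdges_completePairs]
      exact h.blowUp22_four
  · exact blowUpDecomposable_nonDiag h.blowUp22 hs

lemma hasDesign (h : BaseDecompositions G) {n : ℕ} (hn : n % 11 = 0 ∨ n % 11 = 1) :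
    HasDesign G n := by
  have h11 : ∀ t, t = 3 ∨ t = 4 ∨ t = 5 → BlowUpDecomposable G 11 (nonDiag (Fin t)) :=
    fun t ht => by
      rw [← patternEdges_completePairs]
      exact h.blowUp11 t ht
  obtain ⟨t, ht⟩ : ∃ t, n = t * 11 ∨ n = t * 11 + 1 := ⟨n / 11, by omega⟩
  rcases Nat.even_or_odd' t with ⟨s, rfl | rfl⟩
  · by_cases h2 : s = 2
    · subst h2
      exact h.hasDesign_of_blowUp11 (h11 4 (by omega)) ht
    by_cases h5 : s = 5
    · subst h5
      refine h.hasDesign_of_blowUp11 (.of_checkPartition completePairs ?_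
        pairwiseBalancedTen_check.2) ht
      exact fun B hB => h.blowUp11 _ (pairwiseBalancedTen_check.1 B hB)
    · exact h.hasDesign_of_blowUp22 (h.blowUp22_nonDiag h2 h5) (by omega)
  · refine h.hasDesign_of_blowUp11 ?_ ht
    by_cases h2 : s = 2
    · subst h2
      exact h11 5 (by omega)
    by_cases h5 : s = 5
    · subst h5
      refine .of_checkPartition completePairs ?_ pairwiseBalancedEleven_check.2
      exact fun B hB => h.blowUp11 _ (pairwiseBalancedEleven_check.1 B hB)
    -- K_(2s+1)[11] from K_s[22] and the triangles K_3[11] through the added vertex.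
    · refine (BlowUpDecomposable.option_prod (h.blowUp22_nonDiag h2 h5)
        (h11 3 (by omega))).nonDiag_congr (Fintype.equivOfCardEq ?_)
      simp
      ring

end BaseDecompositions

end

/-! ### Format and verification of the base blocks -/

/-- Base blocks, developed cyclically, for decompositions into a theta graph with `10` vertices. -/
structure BaseBlocks where
  complete11 : List (List ℕ)
  complete12 : List (List ℕ)
  complete22 : List (List ℕ)
  complete23 : List (List ℕ)
  triple11 : List (List ℕ)
  quadruple11 : List (List ℕ)
  quintuple11 : List (List ℕ)
  triangle22 : List (List ℕ)
  pendantTriangle22 : List (List ℕ)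
  doublePendantTriangle22 : List (List ℕ)
  quadruple22 : List (List ℕ)

/-- Whether the developed base blocks decompose the complete graph on `N` vertices. -/
def checkComplete (a b c N r k : ℕ) (blocks : List (List ℕ)) : Bool :=
  blocks.all (fun B => B.length == a + b + c - 1) &&
    checkPartition N (completePairs N) ((develop r k blocks).map (·, thetaPairs a b c))

/-- Whether the base blocks have the required properties. -/
def BaseBlocks.check (a b c : ℕ) (D : BaseBlocks) : Bool :=
  (thetaPairs a b c).all (fun p => p.1 != p.2) &&
  -- Designs of orders 11, 12, 22, 23 have 5, 6, 21, 23 copies, and the group orders 5, 3, 7, 23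
  -- divide these. Orders 11 = 2·5+1 and 22 = 3·7+1 leave one fixed point, orders 12 = 4·3 and 23
  -- none.
  checkComplete a b c 11 5 2 D.complete11 &&
  checkComplete a b c 12 3 4 D.complete12 &&
  checkComplete a b c 22 7 3 D.complete22 &&
  checkComplete a b c 23 23 1 D.complete23 &&
  -- The blow-up by r of a graph with e edges has e·r edge orbits and a base block uses 11 of them,
  -- so e base blocks are needed for r = 11 and 2e for r = 22.
  checkDevelopment 3 11 (a + b + c - 1) (completePairs 3) (thetaPairs a b c) D.triple11 &&
  checkDevelopment 4 11 (a + b + c - 1) (completePairs 4) (thetaPairs a b c) D.quadruple11 &&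
  checkDevelopment 5 11 (a + b + c - 1) (completePairs 5) (thetaPairs a b c) D.quintuple11 &&
  checkDevelopment 3 22 (a + b + c - 1) (pendantTrianglePairs 0) (thetaPairs a b c)
    D.triangle22 &&
  checkDevelopment 4 22 (a + b + c - 1) (pendantTrianglePairs 1) (thetaPairs a b c)
    D.pendantTriangle22 &&
  checkDevelopment 5 22 (a + b + c - 1) (pendantTrianglePairs 2) (thetaPairs a b c)
    D.doublePendantTriangle22 &&
  checkDevelopment 4 22 (a + b + c - 1) (completePairs 4) (thetaPairs a b c) D.quadruple22

lemma EdgeDecomposable.of_checkComplete {a b c N r k : ℕ} {blocks : List (List ℕ)}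
    (hG : (thetaGraph a b c).edgeSet = patternEdges (a + b + c - 1) (thetaPairs a b c))
    (h : checkComplete a b c N r k blocks = true) :
    EdgeDecomposable (thetaGraph a b c) (nonDiag (Fin N)) := by
  simp only [checkComplete, Bool.and_eq_true, List.all_eq_true, beq_iff_eq] at h
  refine EdgeDecomposable.of_checkPartition hG ?_ h.2
  simp only [List.all_eq_true, beq_iff_eq, develop, List.mem_flatMap, List.mem_map]
  rintro _ ⟨z, -, B, hB, rfl⟩
  rw [List.length_map, h.1 B hB]

theorem BaseBlocks.baseDecompositions {a b c : ℕ} {D : BaseBlocks} (h : D.check a b c = true) :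
    BaseDecompositions (thetaGraph a b c) := by
  simp only [BaseBlocks.check, Bool.and_eq_true, List.all_eq_true, bne_iff_ne] at h
  obtain ⟨⟨⟨⟨⟨⟨⟨⟨⟨⟨⟨h0, h1⟩, h2⟩, h3⟩, h4⟩, h5⟩, h6⟩, h7⟩, h8⟩, h9⟩, h10⟩, h11⟩ := h
  have hG := edgeSet_thetaGraph h0
  refine ⟨.of_checkComplete hG h1, .of_checkComplete hG h2, .of_checkComplete hG h3,
    .of_checkComplete hG h4, ?_, ?_, checkDevelopment_sound hG h11⟩
  · rintro t (rfl | rfl | rfl)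
    exacts [checkDevelopment_sound hG h5, checkDevelopment_sound hG h6,
      checkDevelopment_sound hG h7]
  · intro p hp
    interval_cases p
    exacts [checkDevelopment_sound hG h8, checkDevelopment_sound hG h9,
      checkDevelopment_sound hG h10]

lemma HasDesign.mod_eleven {W : Type*} [Fintype W] {G : SimpleGraph W} [Fintype G.edgeSet]
    (hG : G.edgeFinset.card = 11) {n : ℕ} (h : HasDesign G n) : n % 11 = 0 ∨ n % 11 = 1 := by
  have hdvd := h.card_edgeFinset_dvd
  rw [hG, Nat.choose_two_right] at hdvd
  rcases Nat.eq_zero_or_pos n with rfl | hpos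
  · exact Or.inl rfl
  have h2 : 11 ∣ n * (n - 1) := by
    have h2 := hdvd.mul_right 2
    rwa [Nat.div_mul_cancel (Nat.even_mul_pred_self n).two_dvd] at h2
  rcases (by norm_num : Nat.Prime 11).dvd_mul.1 h2 with h | h <;> omega

/-! ### Base blocks for the nine theta graphs with 11 edges -/

/-- Base blocks for `thetaGraph 1 2 8`. -/
def baseBlocks128 : BaseBlocks where
  complete11 :=
    [[8, 9, 3, 5, 1, 2, 0, 7, 4, 10]]
  complete12 :=
    [[0, 9, 2, 5, 11, 8, 4, 7, 6, 10], [6, 4, 11, 2, 8, 0, 3, 5, 1, 9]]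
  complete22 :=
    [[21, 4, 17, 12, 18, 8, 6, 11, 9, 10], [10, 7, 18, 0, 15, 13, 5, 1, 17, 14], [14, 9, 2, 19,
    1, 15, 16, 6, 0, 5]]
  complete23 :=
    [[6, 17, 22, 4, 7, 20, 11, 5, 1, 16]]
  triple11 :=
    [[5, 22, 19, 32, 17, 6, 18, 31, 8, 14], [15, 22, 2, 10, 23, 11, 28, 3, 13, 4], [16, 8, 27,
    1, 23, 18, 28, 2, 20, 29]]
  quadruple11 :=
    [[6, 29, 13, 30, 36, 5, 37, 19, 35, 12], [4, 34, 14, 20, 42, 5, 41, 30, 33, 32], [3, 29, 16,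
    23, 9, 27, 43, 15, 36, 1], [26, 15, 4, 18, 42, 32, 0, 33, 14, 24], [43, 17, 9, 25, 34, 6,
    22, 21, 24, 5], [39, 14, 10, 24, 17, 3, 12, 27, 35, 8]]
  quintuple11 :=
    [[8, 53, 36, 21, 2, 52, 33, 27, 49, 16], [25, 34, 0, 37, 14, 53, 21, 35, 19, 29], [46, 11,
    43, 5, 21, 10, 22, 54, 6, 24], [40, 25, 52, 27, 15, 3, 31, 38, 8, 50], [31, 42, 9, 4, 36,
    14, 40, 16, 45, 5], [35, 32, 18, 4, 28, 47, 20, 31, 13, 44], [38, 51, 2, 54, 30, 15, 0, 14,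
    48, 4], [27, 21, 1, 6, 33, 51, 42, 23, 14, 4], [35, 0, 46, 50, 14, 7, 27, 45, 28, 54], [44,
    24, 34, 14, 43, 12, 42, 2, 32, 16]]
  triangle22 :=
    [[28, 53, 9, 11, 50, 12, 26, 3, 25, 4], [61, 8, 33, 16, 25, 59, 38, 54, 36, 55], [4, 36, 44,
    37, 13, 33, 55, 38, 20, 49], [30, 17, 50, 61, 32, 20, 46, 10, 56, 33], [20, 52, 26, 57, 15,
    49, 21, 29, 62, 25], [48, 34, 5, 13, 54, 22, 7, 33, 6, 58]]
  pendantTriangle22 :=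
    [[16, 26, 47, 71, 19, 51, 15, 75, 8, 54], [63, 4, 39, 37, 44, 18, 24, 46, 16, 73], [52, 34,
    14, 41, 60, 13, 38, 21, 74, 8], [9, 53, 38, 33, 17, 40, 48, 39, 2, 36], [58, 24, 13, 23, 4,
    80, 15, 85, 2, 51], [9, 30, 44, 80, 7, 46, 43, 12, 54, 3], [16, 30, 50, 72, 13, 63, 1, 81,
    19, 62], [20, 38, 61, 83, 11, 33, 3, 67, 21, 54]]
  doublePendantTriangle22 :=
    [[53, 28, 7, 30, 6, 98, 14, 46, 34, 12], [1, 43, 60, 66, 14, 87, 10, 63, 39, 54], [23, 59,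
    9, 61, 30, 5, 42, 12, 99, 8], [16, 39, 58, 28, 21, 74, 7, 103, 1, 44], [56, 30, 4, 11, 73,
    5, 69, 12, 81, 21], [61, 39, 21, 43, 15, 96, 8, 91, 20, 46], [65, 22, 5, 9, 53, 4, 101, 0,
    72, 11], [53, 23, 18, 12, 101, 6, 88, 16, 79, 13], [18, 31, 51, 67, 9, 79, 3, 102, 2, 63],
    [3, 22, 50, 93, 17, 103, 18, 77, 21, 57]]
  quadruple22 :=
    [[7, 75, 52, 76, 23, 2, 28, 8, 26, 3], [53, 33, 1, 39, 15, 66, 60, 29, 57, 84], [23, 9, 69,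
    49, 5, 68, 60, 25, 55, 84], [71, 27, 59, 31, 54, 13, 48, 10, 29, 83], [79, 36, 55, 5, 53, 0,
    33, 69, 2, 61], [10, 67, 37, 46, 12, 62, 41, 86, 15, 40], [9, 31, 64, 43, 68, 54, 38, 21,
    34, 58], [69, 43, 14, 44, 22, 51, 67, 2, 86, 6], [7, 58, 77, 23, 84, 44, 79, 37, 6, 67],
    [34, 84, 52, 6, 55, 75, 37, 7, 49, 3], [24, 79, 58, 81, 22, 61, 83, 7, 54, 15], [68, 2, 64,
    51, 84, 43, 58, 4, 82, 45]]

lemma baseBlocks128_check : baseBlocks128.check 1 2 8 = true := by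
  decide +kernel

/-- Base blocks for `thetaGraph 1 3 7`. -/
def baseBlocks137 : BaseBlocks where
  complete11 :=
    [[1, 4, 2, 9, 10, 6, 3, 7, 8, 5]]
  complete12 :=
    [[7, 2, 0, 9, 10, 8, 4, 5, 11, 3], [4, 11, 6, 10, 2, 5, 8, 7, 1, 0]]
  complete22 :=
    [[6, 3, 0, 16, 10, 9, 20, 13, 11, 14], [21, 3, 12, 18, 15, 13, 0, 9, 1, 20], [18, 13, 10, 3,
    15, 14, 16, 2, 4, 9]]
  complete23 :=
    [[21, 11, 15, 3, 18, 22, 1, 19, 5, 12]]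
  triple11 :=
    [[10, 25, 27, 20, 28, 18, 29, 14, 8, 13], [11, 28, 8, 19, 30, 10, 18, 0, 12, 3], [7, 20, 23,
    10, 29, 16, 30, 9, 28, 5]]
  quadruple11 :=
    [[15, 0, 24, 17, 39, 1, 21, 10, 20, 43], [35, 0, 22, 36, 16, 29, 39, 6, 23, 13], [37, 20, 8,
    31, 0, 19, 40, 1, 17, 25], [38, 30, 11, 8, 20, 35, 4, 28, 34, 0], [22, 2, 8, 20, 33, 3, 32,
    37, 17, 29], [20, 26, 23, 41, 42, 22, 18, 43, 31, 5]]
  quintuple11 :=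
    [[18, 39, 43, 15, 48, 4, 38, 8, 16, 3], [18, 23, 53, 13, 29, 4, 51, 3, 43, 46], [16, 35, 10,
    31, 6, 30, 7, 42, 32, 13], [25, 53, 42, 11, 50, 35, 17, 3, 15, 4], [1, 52, 54, 43, 33, 7,
    12, 8, 27, 0], [23, 5, 11, 31, 43, 48, 36, 53, 19, 25], [8, 47, 54, 23, 35, 20, 45, 26, 53,
    40], [38, 25, 22, 18, 46, 20, 2, 24, 36, 8], [37, 21, 14, 53, 23, 20, 22, 40, 32, 54], [52,
    7, 9, 40, 31, 49, 39, 28, 54, 16]]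
  triangle22 :=
    [[41, 7, 63, 23, 52, 28, 54, 20, 64, 27], [22, 19, 3, 62, 14, 43, 12, 30, 49, 42], [33, 9,
    0, 54, 45, 24, 49, 8, 56, 36], [10, 32, 50, 4, 24, 52, 39, 56, 40, 63], [9, 35, 59, 20, 44,
    34, 48, 21, 52, 0], [37, 5, 16, 52, 20, 49, 11, 44, 39, 47]]
  pendantTriangle22 :=
    [[45, 22, 43, 8, 9, 54, 39, 53, 31, 57], [79, 12, 21, 75, 10, 70, 13, 47, 19, 49], [72, 7,
    4, 27, 13, 38, 48, 41, 53, 22], [86, 20, 16, 69, 14, 33, 58, 42, 3, 81], [15, 61, 47, 14,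
    59, 38, 17, 33, 52, 10], [24, 54, 19, 43, 2, 45, 25, 65, 26, 16], [6, 70, 54, 19, 46, 5, 38,
    44, 39, 8], [20, 59, 24, 6, 27, 15, 43, 13, 87, 10]]
  doublePendantTriangle22 :=
    [[47, 11, 43, 50, 37, 1, 92, 3, 36, 44], [101, 9, 16, 67, 0, 97, 11, 24, 19, 37], [71, 6,
    18, 101, 19, 40, 52, 10, 57, 22], [32, 46, 0, 29, 57, 1, 94, 17, 98, 14], [83, 12, 1, 52,
    17, 91, 19, 65, 42, 57], [33, 16, 55, 24, 53, 0, 98, 20, 32, 65], [99, 19, 12, 74, 17, 26,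
    64, 5, 57, 38], [0, 60, 67, 17, 57, 13, 70, 7, 27, 12], [59, 41, 38, 65, 31, 6, 47, 19, 107,
    17], [5, 27, 69, 1, 86, 3, 81, 11, 80, 4]]
  quadruple22 :=
    [[6, 36, 87, 1, 45, 40, 51, 83, 28, 3], [58, 8, 80, 64, 35, 16, 23, 84, 11, 83], [86, 10,
    50, 25, 44, 38, 21, 47, 9, 80], [85, 44, 26, 14, 1, 69, 12, 72, 11, 29], [62, 86, 7, 56, 9,
    53, 74, 19, 24, 55], [65, 83, 14, 49, 25, 81, 48, 7, 33, 9], [73, 24, 6, 48, 22, 80, 0, 42,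
    86, 8], [55, 82, 23, 65, 80, 57, 86, 58, 36, 13], [12, 77, 43, 11, 59, 14, 54, 35, 70, 30],
    [78, 15, 32, 61, 25, 3, 46, 83, 33, 47], [59, 29, 33, 81, 42, 55, 18, 24, 67, 63], [30, 9,
    68, 23, 84, 43, 85, 50, 29, 45]]

lemma baseBlocks137_check : baseBlocks137.check 1 3 7 = true := by
  decide +kernel

/-- Base blocks for `thetaGraph 1 4 6`. -/
def baseBlocks146 : BaseBlocks where
  complete11 :=
    [[3, 2, 7, 10, 0, 8, 9, 6, 4, 5]]
  complete12 :=
    [[5, 6, 10, 3, 8, 11, 0, 4, 7, 2], [0, 10, 5, 4, 1, 2, 8, 11, 7, 9]]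
  complete22 :=
    [[15, 16, 5, 11, 7, 19, 12, 18, 20, 8], [20, 2, 10, 1, 17, 9, 11, 4, 8, 3], [21, 8, 19, 6,
    9, 3, 15, 1, 5, 0]]
  complete23 :=
    [[1, 7, 0, 4, 16, 19, 21, 13, 3, 10]]
  triple11 :=
    [[18, 8, 22, 19, 27, 23, 1, 30, 3, 17], [22, 21, 13, 8, 32, 2, 14, 3, 20, 27], [25, 4, 2,
    17, 30, 0, 28, 18, 5, 12]]
  quadruple11 :=
    [[31, 2, 12, 6, 17, 7, 16, 26, 13, 34], [6, 33, 31, 42, 11, 18, 27, 0, 32, 14], [12, 2, 4,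
    11, 37, 24, 33, 30, 19, 42], [39, 26, 22, 40, 7, 23, 38, 14, 9, 11], [20, 36, 34, 22, 5, 26,
    4, 40, 11, 8], [32, 16, 40, 10, 30, 9, 43, 22, 7, 33]]
  quintuple11 :=
    [[47, 22, 4, 32, 50, 39, 48, 17, 24, 18], [24, 36, 51, 0, 13, 40, 46, 22, 52, 14], [30, 37,
    7, 17, 10, 53, 0, 19, 52, 31], [9, 53, 21, 44, 16, 34, 5, 29, 3, 38], [49, 23, 2, 33, 13,
    17, 36, 4, 54, 14], [7, 48, 40, 51, 2, 28, 15, 9, 35, 18], [44, 22, 43, 17, 33, 20, 31, 1,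
    49, 42], [8, 36, 28, 20, 6, 30, 16, 0, 29, 2], [22, 43, 53, 39, 14, 41, 51, 15, 4, 29], [5,
    50, 14, 30, 34, 20, 33, 12, 24, 37]]
  triangle22 :=
    [[17, 56, 45, 3, 39, 46, 41, 49, 37, 18], [51, 38, 29, 7, 59, 28, 64, 11, 24, 9], [63, 38,
    9, 39, 14, 16, 64, 27, 4, 49], [38, 0, 57, 33, 62, 58, 14, 60, 11, 28], [23, 3, 54, 17, 60,
    13, 22, 50, 32, 58], [7, 63, 48, 32, 5, 41, 8, 34, 13, 31]]
  pendantTriangle22 :=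
    [[21, 27, 83, 4, 53, 37, 5, 66, 17, 55], [22, 17, 58, 41, 54, 9, 52, 43, 3, 70], [86, 14,
    21, 33, 53, 18, 76, 20, 61, 34], [3, 72, 27, 49, 13, 51, 11, 44, 37, 20], [57, 5, 6, 25, 59,
    36, 21, 44, 16, 38], [44, 33, 26, 1, 57, 25, 21, 81, 18, 49], [65, 35, 18, 72, 6, 33, 56,
    14, 69, 21], [64, 7, 39, 9, 30, 27, 18, 62, 16, 80]]
  doublePendantTriangle22 :=
    [[69, 18, 13, 63, 37, 19, 67, 6, 27, 48], [19, 42, 50, 39, 9, 26, 16, 102, 12, 54], [85, 17,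
    8, 55, 32, 9, 88, 7, 63, 34], [101, 10, 18, 36, 45, 16, 52, 3, 63, 23], [104, 2, 5, 48, 40,
    10, 77, 19, 45, 26], [66, 2, 13, 22, 47, 19, 90, 6, 50, 36], [84, 2, 5, 27, 65, 19, 107, 18,
    43, 53], [88, 14, 18, 50, 28, 15, 91, 13, 41, 54], [94, 12, 19, 58, 38, 7, 62, 35, 8, 74],
    [23, 3, 51, 34, 49, 47, 10, 81, 18, 77]]
  quadruple22 :=
    [[35, 64, 81, 57, 5, 67, 0, 26, 74, 27], [62, 32, 17, 87, 8, 20, 59, 15, 65, 2], [16, 71,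
    69, 38, 63, 25, 0, 40, 56, 30], [72, 39, 30, 47, 83, 50, 77, 21, 68, 16], [38, 11, 50, 73,
    33, 57, 29, 79, 7, 65], [86, 46, 45, 76, 8, 4, 59, 3, 52, 67], [11, 82, 30, 65, 19, 73, 9,
    75, 49, 1], [78, 40, 13, 30, 50, 49, 69, 33, 1, 77], [26, 12, 77, 49, 25, 5, 45, 23, 84,
    28], [76, 65, 63, 66, 8, 33, 56, 9, 43, 14], [34, 6, 83, 31, 49, 65, 32, 77, 45, 79], [28,
    8, 55, 34, 69, 13, 24, 60, 77, 61]]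

lemma baseBlocks146_check : baseBlocks146.check 1 4 6 = true := by
  decide +kernel

/-- Base blocks for `thetaGraph 1 5 5`. -/
def baseBlocks155 : BaseBlocks where
  complete11 :=
    [[6, 5, 10, 1, 7, 2, 8, 4, 0, 3]]
  complete12 :=
    [[3, 2, 0, 9, 1, 8, 11, 7, 5, 4], [11, 8, 5, 9, 7, 4, 10, 0, 1, 6]]
  complete22 :=
    [[3, 1, 20, 16, 14, 11, 19, 18, 6, 5], [15, 21, 4, 9, 11, 5, 10, 7, 14, 8], [0, 9, 15, 11,
    10, 18, 20, 6, 13, 5]]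
  complete23 :=
    [[9, 12, 18, 17, 10, 14, 3, 21, 13, 2]]
  triple11 :=
    [[23, 15, 1, 16, 3, 31, 19, 8, 13, 6], [6, 31, 32, 21, 28, 8, 14, 2, 26, 10], [14, 8, 26,
    13, 27, 18, 31, 2, 32, 11]]
  quadruple11 :=
    [[23, 15, 12, 7, 21, 8, 18, 25, 40, 32], [32, 9, 37, 28, 35, 22, 18, 27, 0, 33], [34, 8, 31,
    9, 21, 36, 24, 3, 33, 12], [43, 14, 12, 4, 32, 38, 18, 31, 16, 33], [30, 41, 10, 35, 12, 3,
    42, 0, 26, 1], [19, 9, 2, 36, 14, 41, 8, 26, 16, 28]]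
  quintuple11 :=
    [[2, 32, 37, 5, 42, 4, 22, 15, 54, 0], [8, 24, 16, 40, 14, 49, 21, 33, 26, 52], [42, 51, 44,
    39, 27, 1, 0, 48, 11, 40], [21, 30, 46, 1, 18, 6, 23, 43, 15, 8], [44, 40, 2, 41, 48, 27,
    14, 33, 10, 19], [39, 47, 49, 43, 29, 0, 3, 36, 14, 9], [1, 11, 42, 2, 48, 8, 16, 27, 43,
    44], [22, 51, 33, 29, 14, 24, 19, 35, 27, 37], [0, 11, 23, 46, 27, 51, 25, 19, 50, 30], [17,
    42, 29, 13, 45, 11, 44, 3, 47, 25]]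
  triangle22 :=
    [[21, 58, 55, 25, 9, 42, 38, 51, 8, 31], [57, 19, 11, 43, 50, 31, 17, 46, 10, 58], [28, 65,
    53, 36, 5, 33, 9, 50, 41, 11], [53, 32, 4, 54, 43, 7, 29, 57, 15, 46], [23, 10, 65, 21, 56,
    30, 16, 37, 15, 62], [21, 36, 39, 15, 42, 54, 25, 48, 3, 58]]
  pendantTriangle22 :=
    [[59, 5, 6, 50, 16, 83, 41, 19, 42, 48], [41, 49, 5, 42, 51, 34, 12, 47, 22, 4], [67, 12,
    13, 79, 21, 72, 4, 74, 10, 71], [18, 34, 45, 3, 87, 8, 42, 47, 28, 63], [66, 20, 19, 30, 11,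
    50, 13, 22, 56, 23], [30, 13, 62, 2, 49, 33, 18, 70, 5, 40], [36, 56, 4, 52, 38, 10, 57, 6,
    47, 19], [56, 20, 32, 2, 64, 41, 30, 52, 19, 69]]
  doublePendantTriangle22 :=
    [[98, 4, 12, 39, 48, 35, 0, 78, 5, 54], [18, 76, 54, 15, 106, 2, 35, 51, 27, 21], [96, 17,
    6, 65, 33, 52, 1, 54, 26, 55], [3, 25, 28, 7, 73, 6, 36, 20, 22, 10], [87, 5, 2, 74, 17,
    104, 3, 49, 38, 61], [96, 15, 16, 64, 43, 57, 13, 81, 20, 104], [102, 6, 14, 55, 37, 57, 5,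
    28, 62, 32], [13, 84, 56, 2, 67, 20, 98, 5, 23, 9], [85, 4, 15, 22, 12, 56, 9, 54, 29, 51],
    [0, 35, 30, 45, 12, 52, 92, 14, 34, 61]]
  quadruple22 :=
    [[22, 70, 58, 37, 0, 34, 9, 80, 1, 54], [78, 57, 12, 72, 38, 17, 28, 81, 44, 3], [10, 55,
    73, 43, 18, 80, 77, 21, 76, 38], [75, 35, 24, 18, 60, 16, 7, 66, 2, 45], [62, 12, 10, 30,
    85, 42, 29, 59, 20, 73], [25, 74, 21, 79, 45, 39, 54, 35, 17, 64], [21, 58, 32, 10, 82, 43,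
    28, 44, 74, 20], [73, 27, 3, 30, 48, 74, 56, 22, 6, 54], [26, 12, 70, 52, 74, 47, 49, 29,
    60, 36], [62, 16, 82, 41, 2, 67, 36, 78, 54, 85], [50, 79, 1, 52, 85, 44, 17, 69, 55, 42],
    [43, 12, 46, 24, 14, 48, 75, 52, 80, 35]]

lemma baseBlocks155_check : baseBlocks155.check 1 5 5 = true := by
  decide +kernel

/-- Base blocks for `thetaGraph 2 2 7`. -/
def baseBlocks227 : BaseBlocks where
  complete11 :=
    [[2, 1, 0, 6, 8, 7, 5, 3, 10, 9]]
  complete12 :=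
    [[5, 10, 9, 1, 6, 0, 2, 4, 3, 8], [7, 1, 6, 4, 10, 0, 11, 3, 9, 8]]
  complete22 :=
    [[11, 20, 0, 14, 5, 8, 7, 16, 1, 15], [15, 21, 4, 19, 3, 8, 1, 5, 13, 10], [5, 20, 7, 4, 0,
    17, 12, 10, 14, 13]]
  complete23 :=
    [[0, 18, 1, 13, 2, 9, 5, 8, 22, 7]]
  triple11 :=
    [[1, 3, 12, 18, 17, 10, 20, 25, 9, 26], [30, 2, 16, 15, 13, 23, 9, 24, 0, 32], [1, 32, 20,
    13, 30, 17, 26, 6, 28, 21]]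
  quadruple11 :=
    [[34, 24, 6, 19, 11, 28, 14, 36, 27, 1], [12, 14, 25, 8, 1, 33, 28, 0, 16, 23], [1, 43, 14,
    22, 31, 34, 17, 32, 38, 7], [13, 3, 43, 37, 33, 22, 41, 26, 18, 28], [17, 12, 9, 33, 8, 35,
    28, 1, 25, 5], [36, 1, 23, 11, 6, 41, 29, 17, 5, 38]]
  quintuple11 :=
    [[3, 21, 45, 35, 34, 9, 49, 0, 14, 44], [16, 35, 9, 45, 37, 29, 36, 49, 34, 19], [22, 33,
    15, 51, 19, 47, 36, 53, 6, 32], [16, 53, 25, 8, 6, 54, 0, 44, 17, 23], [19, 26, 52, 4, 44,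
    24, 41, 50, 36, 6], [18, 38, 29, 5, 41, 30, 14, 51, 20, 9], [1, 16, 29, 24, 51, 43, 13, 4,
    31, 10], [52, 25, 0, 40, 31, 36, 26, 8, 27, 50], [10, 37, 23, 15, 11, 32, 17, 41, 21, 53],
    [5, 27, 40, 51, 33, 10, 37, 20, 32, 54]]
  triangle22 :=
    [[40, 56, 0, 16, 48, 43, 52, 33, 19, 22], [35, 53, 0, 15, 57, 3, 64, 12, 54, 28], [15, 27,
    59, 63, 25, 3, 62, 29, 58, 12], [36, 26, 64, 3, 5, 32, 47, 2, 23, 7], [58, 15, 41, 23, 35,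
    53, 29, 1, 48, 27], [58, 32, 15, 3, 1, 64, 14, 65, 16, 52]]
  pendantTriangle22 :=
    [[78, 39, 20, 2, 18, 79, 4, 29, 54, 12], [69, 29, 5, 7, 2, 36, 48, 8, 54, 3], [4, 42, 48,
    63, 78, 13, 79, 11, 67, 19], [31, 27, 49, 51, 21, 84, 11, 29, 0, 56], [26, 35, 61, 15, 5,
    84, 12, 62, 1, 50], [16, 8, 61, 24, 29, 48, 15, 84, 3, 46], [41, 27, 58, 10, 5, 62, 8, 44,
    30, 57], [1, 37, 48, 53, 78, 7, 35, 45, 19, 60]]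
  doublePendantTriangle22 :=
    [[89, 25, 1, 7, 6, 75, 15, 85, 17, 46], [57, 44, 3, 26, 1, 40, 51, 18, 49, 7], [61, 46, 31,
    21, 0, 87, 15, 101, 6, 22], [105, 90, 6, 14, 8, 89, 19, 64, 35, 0], [62, 99, 19, 12, 34, 8,
    39, 10, 83, 3], [44, 15, 27, 30, 39, 58, 6, 87, 8, 71], [5, 19, 25, 24, 94, 16, 65, 33, 58,
    42], [78, 87, 16, 11, 1, 22, 48, 13, 79, 4], [38, 62, 16, 2, 50, 6, 31, 21, 93, 14], [51,
    20, 28, 31, 38, 60, 2, 95, 10, 84]]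
  quadruple22 :=
    [[16, 66, 46, 53, 57, 25, 54, 78, 35, 58], [4, 53, 36, 79, 61, 82, 38, 75, 18, 29], [46, 59,
    71, 32, 42, 82, 8, 81, 53, 76], [55, 15, 42, 39, 71, 38, 56, 17, 40, 51], [35, 20, 87, 54,
    83, 17, 42, 21, 45, 78], [4, 12, 30, 34, 47, 79, 48, 21, 53, 72], [57, 3, 75, 71, 4, 55, 24,
    18, 44, 66], [62, 70, 25, 42, 40, 79, 43, 78, 14, 28], [26, 55, 17, 82, 51, 1, 56, 35, 76,
    11], [17, 59, 29, 66, 34, 80, 10, 39, 70, 14], [36, 32, 83, 17, 1, 48, 6, 82, 20, 81], [19,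
    1, 78, 39, 66, 51, 23, 83, 29, 63]]

lemma baseBlocks227_check : baseBlocks227.check 2 2 7 = true := by
  decide +kernel

/-- Base blocks for `thetaGraph 2 3 6`. -/
def baseBlocks236 : BaseBlocks where
  complete11 :=
    [[3, 1, 4, 9, 5, 10, 7, 0, 8, 6]]
  complete12 :=
    [[8, 3, 11, 7, 5, 10, 0, 2, 6, 1], [0, 10, 6, 3, 9, 11, 4, 8, 5, 1]]
  complete22 :=
    [[21, 18, 1, 19, 7, 8, 15, 16, 20, 2], [10, 1, 13, 8, 7, 6, 4, 0, 14, 2], [2, 3, 10, 15, 13,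
    11, 14, 8, 16, 18]]
  complete23 :=
    [[15, 2, 0, 10, 9, 5, 11, 8, 17, 13]]
  triple11 :=
    [[23, 24, 6, 15, 10, 18, 9, 17, 28, 1], [7, 0, 11, 19, 26, 14, 31, 9, 12, 32], [14, 11, 1,
    8, 32, 28, 15, 27, 7, 26]]
  quadruple11 :=
    [[36, 33, 18, 27, 3, 8, 16, 2, 11, 29], [36, 41, 16, 4, 29, 20, 43, 25, 35, 1], [0, 10, 29,
    15, 30, 21, 3, 38, 17, 31], [17, 25, 36, 34, 9, 29, 7, 13, 23, 42], [23, 7, 18, 0, 38, 37,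
    4, 30, 11, 24], [22, 40, 16, 13, 24, 35, 9, 21, 5, 18]]
  quintuple11 :=
    [[4, 32, 19, 14, 2, 13, 34, 25, 42, 44], [28, 29, 50, 14, 45, 52, 42, 0, 43, 21], [21, 49,
    40, 10, 43, 51, 2, 22, 15, 30], [32, 27, 15, 5, 45, 6, 41, 23, 38, 9], [46, 36, 13, 26, 52,
    11, 4, 38, 14, 6], [22, 48, 0, 9, 34, 8, 52, 10, 46, 14], [7, 13, 53, 52, 41, 35, 15, 54,
    17, 42], [53, 26, 3, 15, 42, 1, 39, 29, 8, 21], [29, 4, 18, 40, 47, 37, 45, 28, 53, 41],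
    [38, 9, 26, 24, 15, 53, 17, 27, 40, 14]]
  triangle22 :=
    [[19, 7, 38, 62, 30, 57, 22, 6, 65, 37], [54, 32, 20, 21, 46, 18, 53, 41, 52, 12], [3, 64,
    35, 44, 22, 54, 15, 40, 55, 11], [52, 23, 10, 28, 1, 33, 59, 34, 51, 5], [33, 46, 16, 7, 28,
    9, 42, 65, 11, 25], [7, 39, 55, 35, 44, 22, 15, 64, 19, 47]]
  pendantTriangle22 :=
    [[19, 20, 61, 23, 50, 34, 9, 84, 17, 69], [10, 40, 58, 46, 17, 67, 5, 65, 32, 49], [6, 50,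
    22, 52, 13, 27, 9, 64, 14, 24], [71, 50, 7, 17, 29, 2, 74, 19, 78, 10], [34, 37, 59, 53, 18,
    44, 31, 61, 27, 20], [8, 1, 28, 62, 25, 66, 3, 36, 0, 83], [18, 9, 65, 63, 40, 74, 8, 36,
    60, 31], [38, 73, 3, 52, 8, 54, 1, 50, 30, 0]]
  doublePendantTriangle22 :=
    [[36, 51, 19, 56, 33, 13, 91, 15, 94, 5], [17, 4, 107, 33, 64, 58, 26, 61, 5, 36], [99, 25,
    5, 14, 51, 3, 68, 9, 87, 19], [85, 39, 21, 19, 63, 1, 65, 35, 0, 51], [58, 65, 22, 9, 38, 6,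
    86, 14, 68, 20], [10, 3, 109, 24, 61, 90, 8, 75, 1, 27], [102, 34, 7, 11, 59, 19, 106, 18,
    29, 51], [53, 0, 25, 6, 79, 14, 36, 65, 3, 85], [75, 57, 14, 0, 41, 20, 90, 4, 73, 2], [1,
    49, 38, 35, 14, 94, 19, 27, 46, 18]]
  quadruple22 :=
    [[9, 37, 73, 36, 4, 49, 20, 63, 81, 60], [5, 51, 76, 77, 7, 34, 64, 11, 45, 87], [1, 30, 65,
    50, 83, 68, 22, 18, 78, 48], [52, 56, 80, 35, 82, 87, 18, 70, 36, 85], [28, 39, 14, 59, 0,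
    4, 82, 42, 44, 16], [8, 13, 28, 53, 31, 84, 29, 80, 23, 65], [76, 72, 19, 60, 24, 44, 12,
    43, 47, 9], [52, 50, 25, 13, 35, 16, 32, 53, 24, 69], [21, 10, 45, 79, 40, 27, 81, 58, 3,
    87], [53, 71, 41, 34, 62, 42, 85, 26, 76, 59], [2, 41, 85, 75, 7, 43, 53, 5, 86, 20], [25,
    68, 63, 12, 53, 67, 2, 49, 71, 30]]

lemma baseBlocks236_check : baseBlocks236.check 2 3 6 = true := by
  decide +kernel

/-- Base blocks for `thetaGraph 2 4 5`. -/
def baseBlocks245 : BaseBlocks where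
  complete11 :=
    [[5, 7, 2, 3, 1, 10, 4, 0, 9, 6]]
  complete12 :=
    [[7, 9, 0, 10, 5, 8, 6, 11, 4, 1], [2, 3, 8, 1, 6, 5, 4, 0, 10, 9]]
  complete22 :=
    [[13, 7, 9, 6, 2, 14, 15, 12, 4, 8], [19, 12, 6, 3, 14, 18, 8, 20, 5, 0], [4, 21, 3, 14, 16,
    17, 18, 10, 1, 11]]
  complete23 :=
    [[16, 12, 5, 2, 20, 22, 13, 7, 15, 11]]
  triple11 :=
    [[11, 10, 29, 3, 13, 30, 31, 8, 32, 17], [27, 11, 0, 2, 19, 6, 13, 9, 18, 23], [10, 26, 13,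
    31, 21, 9, 32, 3, 29, 18]]
  quadruple11 :=
    [[40, 33, 19, 16, 35, 18, 32, 13, 42, 27], [11, 34, 3, 4, 33, 1, 5, 42, 20, 25], [32, 17, 4,
    11, 7, 28, 39, 3, 42, 31], [40, 41, 27, 30, 0, 14, 28, 5, 31, 7], [14, 4, 31, 3, 23, 16, 5,
    21, 0, 29], [14, 17, 26, 34, 10, 32, 27, 43, 2, 40]]
  quintuple11 :=
    [[49, 51, 19, 15, 8, 30, 31, 45, 28, 7], [53, 27, 41, 0, 51, 16, 36, 5, 28, 35], [53, 4, 14,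
    3, 31, 43, 26, 36, 11, 47], [41, 10, 28, 6, 44, 24, 45, 42, 8, 19], [8, 18, 40, 37, 11, 25,
    49, 1, 15, 30], [38, 27, 19, 46, 31, 36, 5, 50, 4, 51], [31, 37, 53, 1, 13, 44, 5, 18, 24,
    0], [37, 20, 1, 50, 39, 22, 47, 24, 8, 38], [35, 7, 12, 18, 42, 11, 14, 54, 17, 27], [40,
    30, 49, 13, 7, 34, 29, 20, 47, 14]]
  triangle22 :=
    [[5, 26, 45, 63, 38, 46, 28, 8, 57, 2], [10, 42, 56, 36, 17, 47, 37, 0, 33, 54], [6, 26, 57,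
    36, 11, 64, 62, 2, 49, 14], [15, 60, 32, 47, 43, 21, 65, 36, 20, 38], [62, 8, 22, 23, 47,
    36, 25, 16, 37, 50], [30, 5, 53, 62, 3, 46, 20, 33, 4, 49]]
  pendantTriangle22 :=
    [[34, 3, 60, 55, 1, 74, 9, 50, 31, 49], [70, 42, 10, 2, 64, 5, 4, 38, 12, 54], [65, 81, 9,
    17, 45, 20, 10, 40, 51, 7], [49, 62, 13, 20, 76, 1, 24, 5, 34, 17], [79, 85, 20, 3, 41, 1,
    10, 48, 25, 5], [40, 30, 45, 56, 32, 62, 18, 23, 59, 7], [8, 20, 75, 78, 15, 29, 41, 50, 22,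
    51], [11, 59, 39, 75, 18, 42, 32, 45, 2, 37]]
  doublePendantTriangle22 :=
    [[93, 76, 0, 6, 84, 13, 8, 54, 37, 1], [84, 64, 2, 16, 65, 12, 5, 101, 3, 28], [18, 32, 60,
    97, 3, 62, 40, 2, 74, 5], [6, 32, 61, 83, 3, 57, 27, 60, 23, 14], [87, 22, 21, 0, 51, 7, 4,
    96, 19, 53], [41, 35, 15, 59, 27, 61, 62, 2, 99, 11], [97, 84, 17, 13, 58, 11, 2, 50, 37,
    20], [53, 3, 37, 34, 15, 93, 31, 55, 14, 73], [21, 51, 28, 103, 20, 31, 60, 3, 89, 8], [65,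
    25, 15, 7, 69, 17, 38, 10, 101, 12]]
  quadruple22 :=
    [[81, 70, 9, 62, 30, 56, 60, 67, 39, 52], [83, 20, 45, 12, 60, 73, 58, 17, 63, 34], [1, 70,
    38, 61, 6, 60, 28, 44, 2, 31], [81, 62, 25, 26, 44, 9, 47, 23, 71, 31], [50, 19, 74, 29, 65,
    38, 87, 48, 37, 73], [50, 43, 11, 33, 58, 15, 10, 67, 44, 74], [85, 8, 57, 28, 50, 30, 54,
    87, 21, 72], [2, 54, 76, 47, 3, 24, 40, 86, 37, 17], [8, 35, 58, 68, 30, 4, 75, 5, 83, 18],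
    [68, 70, 25, 0, 51, 23, 64, 6, 75, 12], [67, 11, 23, 38, 8, 70, 47, 74, 22, 63], [68, 14,
    27, 31, 7, 32, 26, 60, 4, 37]]

lemma baseBlocks245_check : baseBlocks245.check 2 4 5 = true := by
  decide +kernel

/-- Base blocks for `thetaGraph 3 3 5`. -/
def baseBlocks335 : BaseBlocks where
  complete11 :=
    [[2, 3, 0, 9, 10, 8, 5, 7, 6, 4]]
  complete12 :=
    [[1, 10, 3, 8, 9, 4, 6, 0, 2, 11], [5, 7, 8, 11, 2, 6, 4, 0, 10, 3]]
  complete22 :=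
    [[14, 2, 9, 12, 20, 17, 4, 8, 15, 6], [21, 17, 16, 5, 3, 11, 7, 1, 6, 13], [7, 14, 2, 1, 13,
    11, 15, 17, 3, 12]]
  complete23 :=
    [[12, 4, 5, 10, 22, 8, 13, 21, 19, 7]]
  triple11 :=
    [[31, 8, 3, 17, 2, 13, 1, 28, 5, 20], [27, 26, 13, 5, 2, 20, 19, 24, 4, 17], [31, 7, 16, 29,
    21, 22, 20, 27, 3, 13]]
  quadruple11 :=
    [[17, 19, 38, 28, 41, 29, 37, 0, 21, 33], [24, 6, 4, 17, 2, 20, 1, 36, 14, 33], [36, 42, 18,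
    6, 31, 2, 27, 21, 1, 16], [19, 39, 27, 6, 30, 12, 36, 5, 33, 26], [41, 27, 26, 0, 7, 12, 22,
    8, 16, 10], [40, 24, 23, 21, 29, 5, 10, 42, 28, 12]]
  quintuple11 :=
    [[45, 5, 12, 23, 43, 48, 3, 44, 31, 14], [12, 23, 5, 37, 42, 51, 47, 9, 30, 14], [30, 21, 3,
    42, 34, 53, 0, 47, 29, 41], [40, 14, 47, 27, 24, 1, 13, 2, 39, 9], [53, 36, 23, 3, 42, 13,
    8, 39, 14, 48], [39, 45, 28, 18, 5, 20, 30, 8, 48, 42], [46, 33, 2, 48, 23, 8, 31, 52, 13,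
    27], [4, 48, 33, 9, 16, 38, 52, 11, 5, 19], [33, 45, 6, 23, 26, 19, 25, 17, 29, 14], [36,
    21, 19, 34, 26, 2, 23, 50, 25, 0]]
  triangle22 :=
    [[11, 16, 59, 27, 35, 54, 28, 14, 34, 62], [59, 36, 39, 47, 10, 53, 25, 15, 45, 1], [51, 17,
    20, 52, 4, 42, 26, 64, 14, 40], [63, 19, 21, 60, 23, 52, 1, 38, 65, 41], [35, 22, 8, 53, 14,
    65, 48, 12, 49, 15], [23, 55, 15, 33, 17, 29, 46, 31, 0, 41]]
  pendantTriangle22 :=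
    [[12, 55, 82, 11, 60, 2, 84, 7, 23, 3], [32, 18, 5, 84, 48, 37, 46, 43, 45, 39], [86, 55, 1,
    24, 0, 32, 2, 47, 27, 20], [20, 58, 52, 26, 80, 19, 76, 3, 31, 7], [29, 57, 58, 16, 59, 40,
    17, 70, 11, 42], [21, 81, 66, 12, 35, 13, 39, 57, 36, 1], [34, 12, 9, 49, 56, 29, 46, 0, 55,
    42], [18, 40, 46, 3, 52, 14, 70, 5, 54, 7]]
  doublePendantTriangle22 :=
    [[1, 31, 65, 5, 54, 4, 78, 21, 66, 17], [43, 52, 54, 26, 65, 27, 48, 36, 46, 37], [25, 2, 0,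
    84, 10, 89, 44, 23, 65, 41], [106, 15, 18, 34, 7, 52, 10, 53, 6, 37], [91, 20, 15, 90, 5,
    83, 13, 57, 9, 60], [105, 5, 12, 77, 21, 69, 10, 62, 6, 79], [25, 59, 64, 24, 48, 13, 55, 1,
    84, 4], [43, 16, 14, 26, 8, 98, 15, 39, 21, 88], [32, 12, 9, 42, 11, 87, 61, 25, 5, 71],
    [89, 5, 6, 74, 9, 90, 20, 59, 10, 46]]
  quadruple22 :=
    [[62, 17, 38, 81, 73, 37, 75, 33, 60, 67], [51, 4, 34, 59, 72, 63, 22, 19, 73, 43], [11, 41,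
    54, 10, 84, 62, 34, 15, 65, 73], [72, 50, 3, 39, 24, 84, 35, 55, 87, 32], [24, 48, 60, 19,
    0, 40, 16, 50, 31, 87], [83, 50, 43, 70, 38, 5, 60, 22, 48, 1], [23, 56, 10, 72, 58, 20, 1,
    63, 15, 80], [81, 80, 20, 27, 62, 30, 21, 79, 12, 54], [25, 45, 4, 72, 59, 73, 15, 70, 0,
    85], [76, 73, 30, 14, 1, 58, 32, 17, 63, 26], [52, 75, 20, 24, 30, 18, 43, 49, 19, 50], [9,
    82, 48, 25, 87, 16, 83, 42, 15, 43]]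

lemma baseBlocks335_check : baseBlocks335.check 3 3 5 = true := by
  decide +kernel

/-- Base blocks for `thetaGraph 3 4 4`. -/
def baseBlocks344 : BaseBlocks where
  complete11 :=
    [[9, 8, 4, 7, 0, 2, 1, 3, 10, 6]]
  complete12 :=
    [[10, 6, 0, 9, 4, 11, 7, 5, 2, 3], [3, 0, 5, 6, 8, 10, 11, 1, 2, 7]]
  complete22 :=
    [[6, 2, 9, 8, 11, 19, 16, 1, 5, 15], [11, 21, 0, 1, 14, 10, 13, 20, 2, 17], [17, 2, 1, 10,
    15, 8, 14, 16, 11, 9]]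
  complete23 :=
    [[15, 3, 8, 11, 17, 21, 20, 6, 19, 14]]
  triple11 :=
    [[15, 10, 9, 32, 31, 5, 23, 3, 22, 21], [17, 16, 31, 6, 25, 14, 23, 9, 18, 0], [10, 11, 26,
    9, 14, 0, 32, 30, 15, 28]]
  quadruple11 :=
    [[20, 27, 23, 42, 28, 16, 5, 29, 10, 12], [40, 43, 2, 11, 7, 21, 26, 16, 10, 22], [27, 29,
    17, 1, 7, 11, 41, 9, 43, 12], [11, 9, 33, 30, 3, 13, 24, 39, 12, 25], [14, 10, 37, 24, 32,
    8, 36, 39, 3, 34], [1, 37, 42, 26, 33, 15, 8, 13, 39, 30]]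
  quintuple11 :=
    [[19, 17, 38, 0, 28, 43, 2, 50, 18, 23], [33, 49, 52, 36, 11, 43, 32, 5, 15, 26], [54, 7,
    18, 26, 21, 36, 12, 43, 25, 52], [9, 29, 23, 6, 43, 12, 49, 41, 51, 5], [40, 37, 23, 20, 0,
    52, 12, 49, 10, 19], [29, 32, 53, 6, 37, 51, 0, 42, 48, 5], [4, 28, 11, 10, 37, 0, 13, 40,
    26, 47], [20, 47, 48, 13, 50, 1, 32, 6, 37, 25], [42, 8, 32, 19, 54, 25, 50, 15, 27, 43],
    [54, 20, 39, 30, 16, 23, 1, 6, 50, 43]]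
  triangle22 :=
    [[65, 42, 24, 7, 33, 2, 49, 17, 28, 48], [49, 32, 35, 48, 28, 5, 44, 34, 12, 54], [22, 50,
    62, 5, 19, 35, 1, 45, 12, 41], [7, 30, 47, 4, 26, 20, 54, 39, 12, 63], [16, 29, 54, 8, 31,
    11, 55, 24, 6, 59], [22, 59, 61, 7, 47, 42, 18, 8, 58, 0]]
  pendantTriangle22 :=
    [[55, 10, 17, 37, 39, 16, 28, 34, 60, 25], [84, 46, 5, 29, 6, 52, 32, 0, 58, 43], [42, 19,
    12, 72, 4, 44, 22, 48, 43, 62], [83, 6, 3, 56, 12, 63, 32, 16, 55, 37], [59, 19, 4, 78, 5,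
    26, 49, 18, 31, 61], [79, 6, 9, 78, 13, 47, 23, 16, 22, 54], [15, 51, 59, 14, 69, 18, 40,
    80, 3, 39], [73, 29, 9, 58, 5, 37, 18, 12, 47, 0]]
  doublePendantTriangle22 :=
    [[90, 34, 1, 60, 13, 74, 17, 8, 50, 6], [21, 64, 72, 12, 66, 19, 23, 24, 3, 25], [105, 54,
    3, 26, 4, 35, 15, 5, 108, 18], [72, 2, 7, 83, 19, 65, 31, 6, 53, 39], [38, 10, 3, 87, 51,
    40, 50, 2, 35, 44], [86, 10, 16, 68, 1, 51, 26, 14, 33, 48], [21, 101, 70, 14, 62, 35, 8,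
    29, 50, 18], [18, 57, 61, 39, 93, 1, 41, 103, 5, 37], [103, 49, 8, 42, 19, 107, 16, 17, 65,
    41], [12, 14, 61, 38, 106, 10, 45, 76, 8, 59]]
  quadruple22 :=
    [[30, 22, 84, 63, 80, 23, 57, 74, 32, 70], [82, 14, 37, 70, 47, 36, 77, 52, 22, 48], [73,
    56, 48, 15, 26, 51, 34, 6, 33, 76], [21, 81, 85, 48, 31, 0, 54, 47, 8, 65], [58, 26, 35, 19,
    75, 21, 72, 13, 24, 3], [23, 40, 44, 76, 72, 0, 70, 65, 34, 15], [68, 24, 8, 52, 28, 0, 62,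
    2, 79, 10], [9, 49, 24, 11, 51, 37, 20, 55, 83, 22], [9, 43, 33, 3, 62, 84, 61, 74, 16, 53],
    [15, 57, 76, 14, 83, 54, 5, 62, 80, 21], [79, 40, 0, 74, 8, 28, 6, 26, 50, 69], [14, 71, 40,
    47, 67, 30, 45, 64, 73, 59]]

lemma baseBlocks344_check : baseBlocks344.check 3 4 4 = true := by
  decide +kernel

/-! ### The theorem -/

theorem mainTheorem2 (a b c : ℕ) (ha : 1 ≤ a) (hab : a ≤ b) (hbc : b ≤ c) (hb : 2 ≤ b)
    (habc : a + b + c = 11) (n : ℕ) :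
    HasDesign (thetaGraph a b c) n ↔ n ≡ 0 [MOD 11] ∨ n ≡ 1 [MOD 11] := by
  have main : (thetaGraph a b c).edgeFinset.card = 11 ∧ BaseDecompositions (thetaGraph a b c) := by
    obtain rfl : c = 11 - a - b := by omega
    -- From 3a ≤ 11 and 1 + 2b ≤ a + b + c = 11. Of the remaining pairs (a, b), those with b < a or
    -- c < b are contradictory, which leaves nine triples.
    have ha' : a ≤ 3 := by omega
    have hb' : b ≤ 5 := by omega
    interval_cases a <;> interval_cases b <;> first | omega | skip
    · exact ⟨by decide +kernel, BaseBlocks.baseDecompositions baseBlocks128_check⟩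
    · exact ⟨by decide +kernel, BaseBlocks.baseDecompositions baseBlocks137_check⟩
    · exact ⟨by decide +kernel, BaseBlocks.baseDecompositions baseBlocks146_check⟩
    · exact ⟨by decide +kernel, BaseBlocks.baseDecompositions baseBlocks155_check⟩
    · exact ⟨by decide +kernel, BaseBlocks.baseDecompositions baseBlocks227_check⟩
    · exact ⟨by decide +kernel, BaseBlocks.baseDecompositions baseBlocks236_check⟩
    · exact ⟨by decide +kernel, BaseBlocks.baseDecompositions baseBlocks245_check⟩
    · exact ⟨by decide +kernel, BaseBlocks.baseDecompositions baseBlocks335_check⟩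
    · exact ⟨by decide +kernel, BaseBlocks.baseDecompositions baseBlocks344_check⟩
  change _ ↔ n % 11 = 0 ∨ n % 11 = 1
  exact ⟨HasDesign.mod_eleven main.1, main.2.hasDesign⟩
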